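/- **Setting.** Let $s\ge 1$ and let $X_S\in\mathbb R^{s}$ be a random vector of regressors (no intercept component) with covariance matrix $\Sigma_S$. For a real random variable $W$ put $\|W\|_{\psi_2}=\inf\{c>0:\mathbb E\exp(W^2/c^2)\le 2\}$. Let $f(Y)=\beta_SX_S+\varepsilon_S\in\mathbb R^{k_0}$, where $\beta_S\in\mathbb R^{k_0\times s}$ and $\varepsilon_S$ is a centered sub-Gaussian random vector, independent of $X_S$, with covariance matrix $\Gamma_S$. Let $Q\in\mathbb R^{q\times k_0}$. Let $(X_{S,\ell},f(Y_\ell))_{\ell\ge1}$ be i.i.d. samples of this model. For $t\ge 2$ let $Z_S$ be the $t\times s$ matrix with rows $X_{S,1}^T,\dots,X_{S,t}^T$, let $$\widehat\beta_S(t)=\Big((Z_S^TZ_S)^{-1}Z_S^T\,(f(Y_1),\dots,f(Y_t))^T\Big)^T$$ be the least-squares estimate (defined when $Z_S$ has full column rank), and let $$\widehat\Sigma_S(t)=\frac1{t-1}\sum_{\ell\le t}(X_{S,\ell}-\widehat x_S)(X_{S,\ell}-\widehat x_S)^T,\qquad \widehat x_S=\frac1t\sum_{\ell\le t}X_{S,\ell}.$$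 Write $\|\cdot\|_2$ for the spectral norm and $\kappa(\Sigma)=\|\Sigma\|_2\|\Sigma^{-1}\|_2$. **Theorem.** Let $s\ge 1$, $K\ge 1$ and $L,M,\tau>0$. There is a constant $C>0$, depending only on $s,K,L,M,\tau$, with the following property. Suppose that $$\max\Big\{\sup_{\|\theta\|_2=1}\mathbb E[\langle X_S,\theta\rangle^4]^{1/4},\ \big\|\|X_S\|_2\big\|_{\psi_2}\Big\}\le K,$$ and that $\Sigma_S$ is nonsingular with $\|\Sigma_S\|_2\ge\tau$. Then there is $t_0$, depending only on $s,K,L,M,\tau$ and the law of $X_S$, such that the following holds for all $k_0$, $q$, $Q$, $\beta_S$ and all noise vectors $\varepsilon_S$ as above that satisfy $$\|\langle\varepsilon_S,\theta\rangle\|_{\psi_2}\le M\,\big(\mathbb E\langle\varepsilon_S,\theta\rangle^2\big)^{1/2}\quad\text{for all }\theta\in\mathbb R^{k_0},$$ $$\operatorname{tr}(Q\beta_S\beta_S^TQ^T)>0,\qquad \frac{\operatorname{tr}(Q\Gamma_SQ^T)}{\operatorname{tr}(Q\beta_S\beta_S^TQ^T)}\le L.$$ For every $t\ge t_0$, with probability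 at least $1-t^{-2}$, the matrix $Z_S$ has full column rank and $$\frac{\big|\operatorname{tr}(\widehat\Sigma_S(t)\widehat\beta_S(t)^TQ^TQ\widehat\beta_S(t))-\operatorname{tr}(\Sigma_S\beta_S^TQ^TQ\beta_S)\big|}{\operatorname{tr}(\Sigma_S\beta_S^TQ^TQ\beta_S)}\le C\,\kappa(\Sigma_S)\sqrt{\frac{\log t}{t}}.$$ In particular neither $C$ nor $t_0$ depends on the response dimension $k_0$, and $C$ does not depend on $t$. (Every centered sub-Gaussian vector satisfies the noise condition for some $M$, and all centered Gaussian vectors satisfy it for one absolute $M$; every nonsingular $\Sigma_S$ satisfies $\|\Sigma_S\|_2\ge\tau$ for some $\tau>0$.) -/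

import Mathlib

open MeasureTheory ProbabilityTheory
open scoped ENNReal Matrix

noncomputable section

namespace LRMC

/-- The `α`-Orlicz norm `inf {C > 0 : E[exp (|W|^α / C^α)] ≤ 2}` of a real random variable `W`,
with values in `[0, ∞]` (it is `∞` if no such `C` exists). -/
def orliczNorm {Ω : Type*} [MeasurableSpace Ω] (α : ℝ) (W : Ω → ℝ) (μ : Measure Ω) : ℝ≥0∞ :=
  ⨅ (C : ℝ) (_ : 0 < C ∧ ∫⁻ ω, ENNReal.ofReal (Real.exp (|W ω| ^ α / C ^ α)) ∂μ ≤ 2),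
    ENNReal.ofReal C

/-- Covariance matrix of (a random vector with) the law `ν` on `ℝ^d`. -/
def covMatrix {d : ℕ} (ν : Measure (EuclideanSpace ℝ (Fin d))) : Matrix (Fin d) (Fin d) ℝ :=
  Matrix.of fun i j => covariance (fun x => x i) (fun x => x j) ν

/-- Spectral norm (the operator norm for the Euclidean norm) of a square matrix. -/
def specNorm {d : ℕ} (A : Matrix (Fin d) (Fin d) ℝ) : ℝ :=
  ‖Matrix.toEuclideanCLM (n := Fin d) (𝕜 := ℝ) A‖

/-- Condition number `‖A‖₂ ‖A⁻¹‖₂` of a nonsingular matrix. -/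
def condNumber {d : ℕ} (A : Matrix (Fin d) (Fin d) ℝ) : ℝ :=
  specNorm A * specNorm A⁻¹

/-- The `t × d` matrix whose rows are the first `t` vectors of the sequence `v`. For the sequence of
regressor vectors this is the design matrix. -/
def dataMatrix {d : ℕ} (v : ℕ → EuclideanSpace ℝ (Fin d)) (t : ℕ) : Matrix (Fin t) (Fin d) ℝ :=
  Matrix.of fun ℓ i => v ℓ i

/-- Least-squares estimate of the `k × s` coefficient matrix from the first `t` samples: the `j`-th
row is `(Zᵀ Z)⁻¹ Zᵀ y⁽ʲ⁾`, where `Z` is the design matrix and `y⁽ʲ⁾` is the vector of the `j`-th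
coordinates of the responses. It is meaningful when `Z` has full column rank. -/
def betaHat {s k : ℕ} (x : ℕ → EuclideanSpace ℝ (Fin s)) (y : ℕ → EuclideanSpace ℝ (Fin k))
    (t : ℕ) : Matrix (Fin k) (Fin s) ℝ :=
  (((dataMatrix x t)ᵀ * dataMatrix x t)⁻¹ * (dataMatrix x t)ᵀ * dataMatrix y t)ᵀ

/-- Sample mean of the first `t` vectors. -/
def meanHat {s : ℕ} (x : ℕ → EuclideanSpace ℝ (Fin s)) (t : ℕ) : EuclideanSpace ℝ (Fin s) :=
  (1 / (t : ℝ)) • ∑ ℓ ∈ Finset.range t, x ℓ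

/-- Sample covariance matrix `(t - 1)⁻¹ ∑ (x_ℓ - x̂) (x_ℓ - x̂)ᵀ` of the first `t` vectors. -/
def sigmaHat {s : ℕ} (x : ℕ → EuclideanSpace ℝ (Fin s)) (t : ℕ) : Matrix (Fin s) (Fin s) ℝ :=
  (1 / ((t : ℝ) - 1)) • ∑ ℓ ∈ Finset.range t,
    Matrix.vecMulVec (fun i => (x ℓ - meanHat x t) i) (fun i => (x ℓ - meanHat x t) i)

/-- The functional `tr (Σ βᵀ Qᵀ Q β)`. -/
def riskTrace {s k q : ℕ} (Q : Matrix (Fin q) (Fin k) ℝ) (Sg : Matrix (Fin s) (Fin s) ℝ)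
    (β : Matrix (Fin k) (Fin s) ℝ) : ℝ :=
  (Sg * βᵀ * Qᵀ * Q * β).trace

end LRMC

end

namespace LRMC

theorem lintegral_exp_sq_le_two_of_orliczNorm_lt {Ω : Type*} [MeasurableSpace Ω] {μ : Measure Ω}
    {W : Ω → ℝ} {c : ℝ} (h : orliczNorm 2 W μ < ENNReal.ofReal c) :
    ∫⁻ ω, ENNReal.ofReal (Real.exp (W ω ^ 2 / c ^ 2)) ∂μ ≤ 2 := by
  simp only [orliczNorm, iInf_lt_iff] at h
  obtain ⟨C, ⟨hC, hle⟩, hlt⟩ := h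
  have hCc : C ≤ c := by
    by_contra! hcon
    exact absurd hlt (not_lt.mpr (ENNReal.ofReal_le_ofReal hcon.le))
  refine (lintegral_mono fun ω => ENNReal.ofReal_le_ofReal (Real.exp_le_exp.mpr ?_)).trans hle
  rw [Real.rpow_two, Real.rpow_two, sq_abs]
  gcongr

theorem exp_le_add_exp_sq (y : ℝ) : Real.exp y ≤ y + Real.exp (y ^ 2) := by
  rcases le_or_gt |y| 1 with h | h
  · have h1 := (abs_le.mp (Real.abs_exp_sub_one_sub_id_le h)).2
    have h2 := Real.add_one_le_exp (y ^ 2)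
    linarith
  · rcases le_or_gt 0 y with h0 | h0
    · rw [abs_of_nonneg h0] at h
      have : Real.exp y ≤ Real.exp (y ^ 2) := Real.exp_le_exp.mpr (by nlinarith)
      linarith
    · rw [abs_of_neg h0] at h
      have h2 := Real.add_one_le_exp (y ^ 2)
      have h3 : Real.exp y ≤ 1 := Real.exp_le_one_iff.mpr h0.le
      nlinarith

theorem exp_mul_le_one_add {p z : ℝ} (h0 : 0 ≤ p) (h1 : p ≤ 1) :
    Real.exp (p * z) ≤ 1 + p * (Real.exp z - 1) := by
  have := convexOn_exp.2 (Set.mem_univ z) (Set.mem_univ 0) h0 (sub_nonneg.mpr h1) (by ring)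
  simp only [smul_eq_mul, mul_zero, add_zero, Real.exp_zero, mul_one] at this
  linarith

section scalar

variable {Ω : Type*} [MeasurableSpace Ω] {μ : Measure Ω}

theorem integrable_exp_of_lintegral_le {f : Ω → ℝ} {b : ℝ} (hf : AEMeasurable f μ)
    (h : ∫⁻ ω, ENNReal.ofReal (Real.exp (f ω)) ∂μ ≤ ENNReal.ofReal b) :
    Integrable (fun ω => Real.exp (f ω)) μ := by
  refine ⟨hf.exp.aestronglyMeasurable, ?_⟩
  rw [hasFiniteIntegral_iff_ofReal (ae_of_all _ fun ω => (Real.exp_pos _).le)]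
  exact h.trans_lt ENNReal.ofReal_lt_top

theorem integral_exp_le_of_lintegral_le {f : Ω → ℝ} {b : ℝ} (hb : 0 ≤ b) (hf : AEMeasurable f μ)
    (h : ∫⁻ ω, ENNReal.ofReal (Real.exp (f ω)) ∂μ ≤ ENNReal.ofReal b) :
    ∫ ω, Real.exp (f ω) ∂μ ≤ b := by
  rw [integral_eq_lintegral_of_nonneg_ae (ae_of_all _ fun ω => (Real.exp_pos _).le)
    hf.exp.aestronglyMeasurable]
  exact ENNReal.toReal_le_of_le_ofReal hb h

theorem lintegral_exp_mul_gaussianReal (t : ℝ) :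
    ∫⁻ g, ENNReal.ofReal (Real.exp (t * g)) ∂(gaussianReal 0 1) =
      ENNReal.ofReal (Real.exp (t ^ 2 / 2)) := by
  rw [← ofReal_integral_eq_lintegral_ofReal (integrable_exp_mul_gaussianReal t)
    (ae_of_all _ fun ω => (Real.exp_pos _).le)]
  have := congrFun (mgf_id_gaussianReal (μ := 0) (v := 1)) t
  simp only [mgf, id] at this
  rw [this]
  simp

theorem lintegral_exp_sq_gaussianReal_le :
    ∫⁻ g, ENNReal.ofReal (Real.exp (g ^ 2 / 4)) ∂(gaussianReal 0 1) ≤ 2 := by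
  rw [gaussianReal_of_var_ne_zero 0 one_ne_zero,
    lintegral_withDensity_eq_lintegral_mul₀ (by fun_prop) (by fun_prop)]
  have e : ∀ x : ℝ, (gaussianPDF 0 1 * fun g => ENNReal.ofReal (Real.exp (g ^ 2 / 4))) x =
      ENNReal.ofReal ((√(2 * Real.pi))⁻¹ * Real.exp (-(1 / 4) * x ^ 2)) := fun x => by
    simp only [Pi.mul_apply, gaussianPDF, gaussianPDFReal]
    rw [← ENNReal.ofReal_mul (by positivity), mul_assoc, ← Real.exp_add]
    congr 3
    · simp
    · simp; ring
  simp_rw [e]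
  rw [← ofReal_integral_eq_lintegral_ofReal
    ((integrable_exp_neg_mul_sq (by norm_num)).const_mul _)
    (ae_of_all _ fun ω => by positivity), integral_const_mul, integral_gaussian]
  rw [← ENNReal.ofReal_ofNat]
  refine ENNReal.ofReal_le_ofReal ?_
  have hpi := Real.pi_pos
  rw [inv_mul_le_iff₀ (by positivity), Real.sqrt_le_left (by positivity), mul_pow,
    Real.sq_sqrt (by positivity)]
  nlinarith

/-- Convexity of `ψ₂`-bounds: squares with `E exp (vᵢ² / aᵢ) ≤ 2` add up. -/
theorem lintegral_exp_sum_sq_le {ι : Type*} (J : Finset ι) {v : ι → Ω → ℝ} {a : ι → ℝ}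
    (hm : ∀ i ∈ J, Measurable (v i)) (ha : ∀ i ∈ J, 0 ≤ a i)
    (hv0 : ∀ i ∈ J, a i = 0 → ∀ ω, v i ω = 0)
    (hv : ∀ i ∈ J, ∫⁻ ω, ENNReal.ofReal (Real.exp (v i ω ^ 2 / a i)) ∂μ ≤ 2)
    (hT : 0 < ∑ i ∈ J, a i) :
    ∫⁻ ω, ENNReal.ofReal (Real.exp ((∑ i ∈ J, v i ω ^ 2) / ∑ i ∈ J, a i)) ∂μ ≤ 2 := by
  set T := ∑ i ∈ J, a i with hTdef
  have hpt : ∀ ω, Real.exp ((∑ i ∈ J, v i ω ^ 2) / T) ≤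
      ∑ i ∈ J, a i / T * Real.exp (v i ω ^ 2 / a i) := fun ω => by
    have hsum : (∑ i ∈ J, v i ω ^ 2) / T = ∑ i ∈ J, (a i / T) • (v i ω ^ 2 / a i) := by
      rw [Finset.sum_div]
      refine Finset.sum_congr rfl fun i hi => ?_
      rcases eq_or_ne (a i) 0 with h | h
      · simp [hv0 i hi h, h]
      · rw [smul_eq_mul]; field_simp
    rw [hsum]
    refine (convexOn_exp.map_sum_le (fun i hi => div_nonneg (ha i hi) hT.le) ?_
      fun i _ => Set.mem_univ _)
    rw [← Finset.sum_div, ← hTdef, div_self hT.ne']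
  calc ∫⁻ ω, ENNReal.ofReal (Real.exp ((∑ i ∈ J, v i ω ^ 2) / T)) ∂μ
      ≤ ∫⁻ ω, ∑ i ∈ J, ENNReal.ofReal (a i / T) * ENNReal.ofReal (Real.exp (v i ω ^ 2 / a i)) ∂μ := by
        refine lintegral_mono fun ω => (ENNReal.ofReal_le_ofReal (hpt ω)).trans (le_of_eq ?_)
        rw [ENNReal.ofReal_sum_of_nonneg fun i hi =>
          mul_nonneg (div_nonneg (ha i hi) hT.le) (Real.exp_pos _).le]
        exact Finset.sum_congr rfl fun i hi => ENNReal.ofReal_mul (div_nonneg (ha i hi) hT.le)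
    _ = ∑ i ∈ J, ENNReal.ofReal (a i / T) *
          ∫⁻ ω, ENNReal.ofReal (Real.exp (v i ω ^ 2 / a i)) ∂μ := by
        rw [lintegral_finsetSum']
        · refine Finset.sum_congr rfl fun i hi => ?_
          have := hm i hi
          rw [lintegral_const_mul _ (by fun_prop)]
        · intro i hi
          have := hm i hi
          fun_prop
    _ ≤ ∑ i ∈ J, ENNReal.ofReal (a i / T) * 2 := by
        gcongr with i hi
        exact hv i hi
    _ = 2 := by
        rw [← Finset.sum_mul, ← ENNReal.ofReal_sum_of_nonneg fun i hi => div_nonneg (ha i hi) hT.le,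
          ← Finset.sum_div, ← hTdef, div_self hT.ne']
        simp

theorem abs_integral_le_of_lintegral_exp_abs {U : Ω → ℝ} {κ : ℝ} (hκ : 0 < κ)
    (hU : AEMeasurable U μ) (h : ∫⁻ ω, ENNReal.ofReal (Real.exp (|U ω| / κ)) ∂μ ≤ 4) :
    Integrable U μ ∧ |∫ ω, U ω ∂μ| ≤ 4 * κ := by
  have h' : ∫⁻ ω, ENNReal.ofReal (Real.exp (|U ω| / κ)) ∂μ ≤ ENNReal.ofReal 4 := by simpa using h
  have hm : AEMeasurable (fun ω => |U ω| / κ) μ := hU.norm.div_const κ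
  have hint := integrable_exp_of_lintegral_le hm h'
  have hle := integral_exp_le_of_lintegral_le (by norm_num) hm h'
  have hpt : ∀ ω, ‖U ω‖ ≤ κ * Real.exp (|U ω| / κ) := fun ω => by
    rw [Real.norm_eq_abs, mul_comm, ← div_le_iff₀ hκ]
    linarith [Real.add_one_le_exp (|U ω| / κ)]
  refine ⟨(hint.const_mul κ).mono' hU.aestronglyMeasurable (ae_of_all _ hpt), ?_⟩
  refine (norm_integral_le_of_norm_le (hint.const_mul κ) (ae_of_all _ hpt)).trans ?_
  rw [integral_const_mul]
  nlinarith

variable [IsProbabilityMeasure μ]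

theorem integral_exp_mul_le {f : Ω → ℝ} {b p : ℝ} (hf : AEMeasurable f μ) (hb : 0 ≤ b)
    (h : ∫⁻ ω, ENNReal.ofReal (Real.exp (f ω)) ∂μ ≤ ENNReal.ofReal b)
    (h0 : 0 ≤ p) (h1 : p ≤ 1) :
    Integrable (fun ω => Real.exp (p * f ω)) μ ∧
      ∫ ω, Real.exp (p * f ω) ∂μ ≤ 1 + p * (b - 1) := by
  have hint := integrable_exp_of_lintegral_le hf h
  have hg : Integrable (fun ω => 1 + p * (Real.exp (f ω) - 1)) μ := by fun_prop
  have hi : Integrable (fun ω => Real.exp (p * f ω)) μ :=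
    hg.mono' (hf.const_mul p).exp.aestronglyMeasurable (ae_of_all _ fun ω => by
      rw [Real.norm_eq_abs, abs_of_pos (Real.exp_pos _)]
      exact exp_mul_le_one_add h0 h1)
  refine ⟨hi, (integral_mono hi hg fun ω => exp_mul_le_one_add h0 h1).trans ?_⟩
  rw [integral_add (by fun_prop) (by fun_prop), integral_const_mul,
    integral_sub hint (by fun_prop)]
  have := integral_exp_le_of_lintegral_le hb hf h
  simp only [integral_const, probReal_univ, smul_eq_mul, mul_one]
  gcongr

/-- A centered variable with `E exp (W² / c²) ≤ 2` has a sub-Gaussian moment generating function. -/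
theorem hasSubgaussianMGF_of_lintegral_exp_sq {W : Ω → ℝ} {c : ℝ} (hc : 0 < c)
    (hW : AEMeasurable W μ) (h0 : ∫ ω, W ω ∂μ = 0)
    (h : ∫⁻ ω, ENNReal.ofReal (Real.exp (W ω ^ 2 / c ^ 2)) ∂μ ≤ 2) :
    HasSubgaussianMGF W (2 * c ^ 2).toNNReal μ := by
  have h' : ∫⁻ ω, ENNReal.ofReal (Real.exp (W ω ^ 2 / c ^ 2)) ∂μ ≤ ENNReal.ofReal 2 := by
    simpa using h
  have hm : AEMeasurable (fun ω => W ω ^ 2 / c ^ 2) μ := (hW.pow_const 2).div_const _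
  have hint := integrable_exp_of_lintegral_le hm h'
  have hpt : ∀ l ω, l * W ω ≤ l ^ 2 * c ^ 2 / 2 + 1 / 2 * (W ω ^ 2 / c ^ 2) := fun l ω => by
    have : 0 ≤ (l * c - W ω / c) ^ 2 := sq_nonneg _
    have e : (l * c - W ω / c) ^ 2 = l ^ 2 * c ^ 2 - 2 * (l * W ω) + W ω ^ 2 / c ^ 2 := by
      field_simp
      ring
    linarith
  have half := integral_exp_mul_le hm (by norm_num) h' (p := 1 / 2) (by norm_num) (by norm_num)
  have hintl : ∀ l, Integrable (fun ω => Real.exp (l * W ω)) μ := fun l => by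
    refine (half.1.const_mul (Real.exp (l ^ 2 * c ^ 2 / 2))).mono'
      (hW.const_mul l).exp.aestronglyMeasurable (ae_of_all _ fun ω => ?_)
    rw [Real.norm_eq_abs, abs_of_pos (Real.exp_pos _), ← Real.exp_add]
    exact Real.exp_le_exp.mpr (hpt l ω)
  refine ⟨hintl, fun l => ?_⟩
  rw [Real.coe_toNNReal _ (by positivity), mgf]
  have e : 2 * c ^ 2 * l ^ 2 / 2 = l ^ 2 * c ^ 2 := by ring
  rw [e]
  rcases le_total (l ^ 2 * c ^ 2) 1 with hl | hl
  · have A := integral_exp_mul_le hm (by norm_num) h' (p := l ^ 2 * c ^ 2) (by positivity) hl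
    have e2 : ∀ ω, l ^ 2 * c ^ 2 * (W ω ^ 2 / c ^ 2) = (l * W ω) ^ 2 := fun ω => by
      field_simp
    simp only [e2] at A
    have hWint : Integrable W μ := by
      refine (hint.const_mul c).mono' hW.aestronglyMeasurable (ae_of_all _ fun ω => ?_)
      have h1 : |W ω| / c ≤ (W ω / c) ^ 2 + 1 := by
        rw [← sq_abs (W ω / c), abs_div, abs_of_pos hc]
        nlinarith [sq_nonneg (|W ω| / c - 1 / 2)]
      have h2 := Real.add_one_le_exp ((W ω / c) ^ 2)
      rw [div_pow] at h1 h2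
      rw [Real.norm_eq_abs, mul_comm, ← div_le_iff₀ hc]
      linarith
    calc ∫ ω, Real.exp (l * W ω) ∂μ ≤ ∫ ω, (l * W ω + Real.exp ((l * W ω) ^ 2)) ∂μ :=
          integral_mono (hintl l) ((hWint.const_mul l).add A.1) fun ω => exp_le_add_exp_sq _
      _ = ∫ ω, Real.exp ((l * W ω) ^ 2) ∂μ := by
          rw [integral_add (hWint.const_mul l) A.1, integral_const_mul, h0]
          ring
      _ ≤ 1 + l ^ 2 * c ^ 2 * (2 - 1) := A.2
      _ ≤ Real.exp (l ^ 2 * c ^ 2) := by linarith [Real.add_one_le_exp (l ^ 2 * c ^ 2)]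
  · calc ∫ ω, Real.exp (l * W ω) ∂μ
        ≤ ∫ ω, Real.exp (l ^ 2 * c ^ 2 / 2) * Real.exp (1 / 2 * (W ω ^ 2 / c ^ 2)) ∂μ :=
          integral_mono (hintl l) (half.1.const_mul _) fun ω => by
            simp only [← Real.exp_add]
            exact Real.exp_le_exp.mpr (hpt l ω)
      _ ≤ Real.exp (l ^ 2 * c ^ 2 / 2) * Real.exp (1 / 2) := by
          rw [integral_const_mul]
          gcongr
          refine half.2.trans ?_
          linarith [Real.add_one_le_exp (1 / 2 : ℝ)]
      _ ≤ Real.exp (l ^ 2 * c ^ 2) := by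
          rw [← Real.exp_add]
          exact Real.exp_le_exp.mpr (by linarith)

/-- Integrated sub-Gaussian bound: `E exp (v² / (4 V)) ≤ 2` if `v` has variance proxy `V`. -/
theorem lintegral_exp_sq_le_of_hasSubgaussianMGF {v : Ω → ℝ} {V : NNReal} (hV : 0 < V)
    (hm : Measurable v) (h : HasSubgaussianMGF v V μ) :
    ∫⁻ ω, ENNReal.ofReal (Real.exp (v ω ^ 2 / (4 * V))) ∂μ ≤ 2 := by
  have hV' : (0 : ℝ) < V := hV
  set r : ℝ := √(1 / (2 * V)) with hr
  have hr2 : r ^ 2 = 1 / (2 * V) := Real.sq_sqrt (by positivity)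
  calc ∫⁻ ω, ENNReal.ofReal (Real.exp (v ω ^ 2 / (4 * V))) ∂μ
      = ∫⁻ ω, ∫⁻ g, ENNReal.ofReal (Real.exp (r * v ω * g)) ∂(gaussianReal 0 1) ∂μ := by
        refine lintegral_congr fun ω => ?_
        rw [lintegral_exp_mul_gaussianReal, mul_pow, hr2]
        congr 2
        field_simp
        norm_num
    _ = ∫⁻ g, ∫⁻ ω, ENNReal.ofReal (Real.exp (r * v ω * g)) ∂μ ∂(gaussianReal 0 1) :=
        lintegral_lintegral_swap (by fun_prop)
    _ ≤ ∫⁻ g, ENNReal.ofReal (Real.exp (g ^ 2 / 4)) ∂(gaussianReal 0 1) := by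
        refine lintegral_mono fun g => ?_
        have e : ∀ ω, r * v ω * g = r * g * v ω := fun ω => by ring
        simp_rw [e]
        rw [← ofReal_integral_eq_lintegral_ofReal (h.integrable_exp_mul _)
          (ae_of_all _ fun ω => (Real.exp_pos _).le)]
        refine ENNReal.ofReal_le_ofReal ((h.mgf_le (r * g)).trans (Real.exp_le_exp.mpr ?_))
        rw [mul_pow, hr2]
        refine le_of_eq ?_
        field_simp
        ring
    _ ≤ 2 := lintegral_exp_sq_gaussianReal_le

/-- Bernstein-type bound for the moment generating function of a sub-exponential variable. -/
theorem mgf_le_of_lintegral_exp_abs {U : Ω → ℝ} {κ l : ℝ} (hκ : 0 < κ) (hU : AEMeasurable U μ)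
    (h : ∫⁻ ω, ENNReal.ofReal (Real.exp (|U ω| / κ)) ∂μ ≤ 4) (hl : |l| * κ ≤ 1 / 2) :
    Integrable (fun ω => Real.exp (l * U ω)) μ ∧
      mgf U μ l ≤ Real.exp (l * ∫ ω, U ω ∂μ + 32 * l ^ 2 * κ ^ 2) := by
  have h' : ∫⁻ ω, ENNReal.ofReal (Real.exp (|U ω| / κ)) ∂μ ≤ ENNReal.ofReal 4 := by simpa using h
  have hm : AEMeasurable (fun ω => |U ω| / κ) μ := hU.norm.div_const κ
  have hint := integrable_exp_of_lintegral_le hm h'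
  have hle := integral_exp_le_of_lintegral_le (by norm_num) hm h'
  have hUint : Integrable U μ := by
    refine (hint.const_mul κ).mono' hU.aestronglyMeasurable (ae_of_all _ fun ω => ?_)
    rw [Real.norm_eq_abs, mul_comm, ← div_le_iff₀ hκ]
    linarith [Real.add_one_le_exp (|U ω| / κ)]
  have hpt : ∀ ω, Real.exp (l * U ω) ≤
      1 + l * U ω + 8 * l ^ 2 * κ ^ 2 * Real.exp (|U ω| / κ) := fun ω => by
    have key : ∀ y : ℝ, Real.exp y ≤ 1 + y + y ^ 2 * Real.exp |y| := fun y => by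
      have := Complex.norm_exp_sub_sum_le_norm_mul_exp (y : ℂ) 2
      simp only [Finset.sum_range_succ, Finset.sum_range_zero, Nat.factorial] at this
      norm_num at this
      rw [← Complex.ofReal_exp, ← Complex.ofReal_one, ← Complex.ofReal_add, ← Complex.ofReal_sub,
        Complex.norm_real, Real.norm_eq_abs] at this
      linarith [le_abs_self (Real.exp y - (1 + y))]
    have k1 := key (l * U ω)
    have k2 := Real.quadratic_le_exp_of_nonneg (x := |U ω| / (2 * κ)) (by positivity)
    have k3 : (|U ω| / (2 * κ)) ^ 2 / 2 ≤ Real.exp (|U ω| / (2 * κ)) := by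
      have : 0 ≤ |U ω| / (2 * κ) := by positivity
      linarith
    have k4 : |l * U ω| ≤ |U ω| / (2 * κ) := by
      rw [abs_mul, le_div_iff₀ (by positivity)]
      nlinarith [abs_nonneg (U ω)]
    have k5 : Real.exp |l * U ω| ≤ Real.exp (|U ω| / (2 * κ)) := Real.exp_le_exp.mpr k4
    have e1 : (l * U ω) ^ 2 = 8 * l ^ 2 * κ ^ 2 * ((|U ω| / (2 * κ)) ^ 2 / 2) := by
      rw [div_pow, sq_abs]
      field_simp
      norm_num
    have e2 : Real.exp (|U ω| / κ) = Real.exp (|U ω| / (2 * κ)) * Real.exp (|U ω| / (2 * κ)) := by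
      rw [← Real.exp_add]
      congr 1
      field_simp
      norm_num
    refine k1.trans ?_
    rw [e1, e2, mul_assoc (8 * l ^ 2 * κ ^ 2)]
    gcongr
  have hdom : Integrable
      (fun ω => 1 + l * U ω + 8 * l ^ 2 * κ ^ 2 * Real.exp (|U ω| / κ)) μ :=
    ((integrable_const _).add (hUint.const_mul l)).add (hint.const_mul _)
  have hi : Integrable (fun ω => Real.exp (l * U ω)) μ :=
    hdom.mono' (hU.const_mul l).exp.aestronglyMeasurable (ae_of_all _ fun ω => by
      rw [Real.norm_eq_abs, abs_of_pos (Real.exp_pos _)]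
      exact hpt ω)
  refine ⟨hi, (integral_mono hi hdom hpt).trans ?_⟩
  rw [integral_add (by fun_prop) (by fun_prop), integral_add (by fun_prop) (by fun_prop),
    integral_const_mul, integral_const_mul]
  simp only [integral_const, probReal_univ, smul_eq_mul, mul_one]
  have : 8 * l ^ 2 * κ ^ 2 * ∫ ω, Real.exp (|U ω| / κ) ∂μ ≤ 8 * l ^ 2 * κ ^ 2 * 4 := by gcongr
  linarith [Real.add_one_le_exp (l * ∫ ω, U ω ∂μ + 32 * l ^ 2 * κ ^ 2)]

end scalar

section mean

variable {Ω : Type*} [MeasurableSpace Ω] {μ : Measure Ω} [IsProbabilityMeasure μ]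

theorem measure_mean_sub_ge_le {U : ℕ → Ω → ℝ} {κ m : ℝ} (hκ : 0 < κ)
    (hU : ∀ ℓ, Measurable (U ℓ)) (hind : iIndepFun U μ)
    (h : ∀ ℓ, ∫⁻ ω, ENNReal.ofReal (Real.exp (|U ℓ ω| / κ)) ∂μ ≤ 4)
    (hmean : ∀ ℓ, ∫ ω, U ℓ ω ∂μ = m) {t : ℕ} (ht : 0 < t)
    (hρ : √(Real.log t / t) ≤ 1 / 2) :
    μ.real {ω | 35 * κ * √(Real.log t / t) ≤ 1 / (t : ℝ) * (∑ ℓ ∈ Finset.range t, U ℓ ω) - m} ≤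
      1 / (t : ℝ) ^ 3 := by
  have ht' : (0 : ℝ) < t := Nat.cast_pos.mpr ht
  set r := √(Real.log t / t) with hr
  have hr0 : 0 ≤ r := Real.sqrt_nonneg _
  have hr2 : r ^ 2 * t = Real.log t := by
    rw [hr, Real.sq_sqrt (div_nonneg (Real.log_natCast_nonneg t) ht'.le)]
    field_simp
  have hl0 : 0 ≤ r / κ := by positivity
  have hlκ : |r / κ| * κ ≤ 1 / 2 := by
    rw [abs_of_nonneg hl0, div_mul_cancel₀ _ hκ.ne']
    exact hρ
  have hb := fun ℓ => mgf_le_of_lintegral_exp_abs hκ (hU ℓ).aemeasurable (h ℓ) hlκ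
  have hset : {ω | 35 * κ * r ≤ 1 / (t : ℝ) * (∑ ℓ ∈ Finset.range t, U ℓ ω) - m} =
      {ω | t * (35 * κ * r + m) ≤ (∑ ℓ ∈ Finset.range t, U ℓ) ω} := by
    ext ω
    simp only [Set.mem_ofPred_eq, Finset.sum_apply]
    rw [le_sub_iff_add_le, one_div, ← div_eq_inv_mul, le_div_iff₀' ht']
  rw [hset]
  refine (measure_ge_le_exp_mul_mgf _ hl0
    (hind.integrable_exp_mul_sum hU fun ℓ _ => (hb ℓ).1)).trans ?_
  rw [hind.mgf_sum hU]
  have hp : ∏ ℓ ∈ Finset.range t, mgf (U ℓ) μ (r / κ) ≤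
      Real.exp (r / κ * m + 32 * (r / κ) ^ 2 * κ ^ 2) ^ t := by
    refine (Finset.prod_le_prod (fun _ _ => mgf_nonneg) fun ℓ _ => (hb ℓ).2).trans ?_
    simp [hmean]
  refine (mul_le_mul_of_nonneg_left hp (Real.exp_pos _).le).trans ?_
  rw [← Real.exp_nat_mul, ← Real.exp_add]
  have e : -(r / κ) * (t * (35 * κ * r + m)) + t * (r / κ * m + 32 * (r / κ) ^ 2 * κ ^ 2) =
      -(3 * Real.log t) := by
    rw [← hr2]
    field_simp
    ring
  rw [e, Real.exp_neg, mul_comm, Real.exp_mul, Real.exp_log ht', one_div]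
  norm_cast

theorem measure_abs_mean_sub_ge_le {U : ℕ → Ω → ℝ} {κ m : ℝ} (hκ : 0 < κ)
    (hU : ∀ ℓ, Measurable (U ℓ)) (hind : iIndepFun U μ)
    (h : ∀ ℓ, ∫⁻ ω, ENNReal.ofReal (Real.exp (|U ℓ ω| / κ)) ∂μ ≤ 4)
    (hmean : ∀ ℓ, ∫ ω, U ℓ ω ∂μ = m) {t : ℕ} (ht : 0 < t)
    (hρ : √(Real.log t / t) ≤ 1 / 2) :
    μ.real {ω | 35 * κ * √(Real.log t / t) ≤
      |1 / (t : ℝ) * (∑ ℓ ∈ Finset.range t, U ℓ ω) - m|} ≤ 2 / (t : ℝ) ^ 3 := by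
  have h1 := measure_mean_sub_ge_le hκ hU hind h hmean ht hρ
  have h2 := measure_mean_sub_ge_le (U := fun ℓ ω => -U ℓ ω) (m := -m) hκ
    (fun ℓ => (hU ℓ).neg) (hind.comp (fun _ x => -x) fun _ => measurable_neg)
    (by simpa using h) (fun ℓ => by rw [integral_neg, hmean]) ht hρ
  have hsub : {ω | 35 * κ * √(Real.log t / t) ≤
        |1 / (t : ℝ) * (∑ ℓ ∈ Finset.range t, U ℓ ω) - m|} ⊆
      {ω | 35 * κ * √(Real.log t / t) ≤ 1 / (t : ℝ) * (∑ ℓ ∈ Finset.range t, U ℓ ω) - m} ∪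
      {ω | 35 * κ * √(Real.log t / t) ≤ 1 / (t : ℝ) * (∑ ℓ ∈ Finset.range t, -U ℓ ω) - -m} := by
    intro ω hω
    rw [Set.mem_ofPred_eq, le_abs] at hω
    rcases hω with hω | hω
    · exact Or.inl hω
    · refine Or.inr ?_
      simp only [Set.mem_ofPred_eq, Finset.sum_neg_distrib]
      linarith
  calc _ ≤ _ := measureReal_mono hsub
    _ ≤ _ := measureReal_union_le _ _
    _ ≤ 1 / (t : ℝ) ^ 3 + 1 / (t : ℝ) ^ 3 := add_le_add h1 h2
    _ = 2 / (t : ℝ) ^ 3 := by ring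

end mean

section noise

/-- Squared Frobenius norm of the projection of `W` onto the column space of `Z`. -/
noncomputable def projSq {s t q : ℕ} (Z : Matrix (Fin t) (Fin s) ℝ) (W : Matrix (Fin t) (Fin q) ℝ) : ℝ :=
  ∑ p : Fin t × Fin q, (Z * (Zᵀ * Z)⁻¹ * Zᵀ * W) p.1 p.2 ^ 2

theorem projSq_eq {s t q : ℕ} (Z : Matrix (Fin t) (Fin s) ℝ) (W : Matrix (Fin t) (Fin q) ℝ) :
    projSq Z W = ∑ p : Fin t × Fin q, (Z * (Zᵀ * Z)⁻¹ * Zᵀ * W) p.1 p.2 ^ 2 := rfl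

attribute [irreducible] projSq

theorem sum_sq_projection_le {s t : ℕ} (Z : Matrix (Fin t) (Fin s) ℝ) :
    ∑ ℓ, ∑ k, (Z * (Zᵀ * Z)⁻¹ * Zᵀ) ℓ k ^ 2 ≤ s := by
  set P := Z * (Zᵀ * Z)⁻¹ * Zᵀ with hP
  by_cases hdet : IsUnit (Zᵀ * Z).det
  · have hsymm : Pᵀ = P := by
      rw [hP, Matrix.transpose_mul, Matrix.transpose_mul, Matrix.transpose_nonsing_inv,
        Matrix.transpose_mul, Matrix.transpose_transpose, Matrix.mul_assoc]
    have hidem : P * P = P := by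
      calc P * P = Z * (((Zᵀ * Z)⁻¹ * (Zᵀ * Z)) * (Zᵀ * Z)⁻¹) * Zᵀ := by
            simp only [hP, Matrix.mul_assoc]
        _ = P := by rw [Matrix.nonsing_inv_mul _ hdet, Matrix.one_mul]
    have htr : P.trace = s := by
      rw [hP, Matrix.mul_assoc, Matrix.trace_mul_comm, Matrix.mul_assoc,
        Matrix.nonsing_inv_mul _ hdet, Matrix.trace_one, Fintype.card_fin]
    have : ∑ ℓ, ∑ k, P ℓ k ^ 2 = (P * Pᵀ).trace := by
      simp only [Matrix.trace, Matrix.diag, Matrix.mul_apply, Matrix.transpose_apply, sq]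
    rw [this, hsymm, hidem, htr]
  · have : P = 0 := by rw [hP, Matrix.nonsing_inv_apply_not_isUnit _ hdet]; simp
    simp [this]

variable {E : Type*} [MeasurableSpace E] {ρ : Measure E} [IsProbabilityMeasure ρ]

theorem hasSubgaussianMGF_linear_combination {t : ℕ} {η : E → ℝ} {V : NNReal}
    (hη : Measurable η) (h : HasSubgaussianMGF η V ρ) (u : Fin t → ℝ) :
    HasSubgaussianMGF (fun e : Fin t → E => ∑ ℓ, u ℓ * η (e ℓ))
      (∑ ℓ, ⟨u ℓ ^ 2, sq_nonneg _⟩ * V) (Measure.pi fun _ => ρ) := by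
  refine HasSubgaussianMGF.sum_of_iIndepFun (s := Finset.univ)
    (X := fun ℓ (e : Fin t → E) => u ℓ * η (e ℓ))
    (iIndepFun_pi (X := fun ℓ x => u ℓ * η x) fun ℓ => (hη.const_mul _).aemeasurable)
    fun ℓ _ => ?_
  have : HasSubgaussianMGF (fun x => u ℓ * η x) (⟨u ℓ ^ 2, sq_nonneg _⟩ * V) ρ := h.const_mul (u ℓ)
  refine HasSubgaussianMGF.of_map (Y := fun e : Fin t → E => e ℓ)
    (X := fun x => u ℓ * η x) (measurable_pi_apply ℓ).aemeasurable ?_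
  rwa [(measurePreserving_eval (fun _ : Fin t => ρ) ℓ).map_eq]

theorem lintegral_exp_projSq_le {s t q : ℕ} (hs : 0 < s) (Z : Matrix (Fin t) (Fin s) ℝ)
    {η : Fin q → E → ℝ} {V : Fin q → NNReal} (hη : ∀ j, Measurable (η j)) (hV : ∀ j, 0 < V j)
    (h : ∀ j, HasSubgaussianMGF (η j) (V j) ρ) (hVsum : 0 < ∑ j, (V j : ℝ)) :
    ∫⁻ e, ENNReal.ofReal (Real.exp
      (projSq Z (Matrix.of fun ℓ j => η j (e ℓ)) / (4 * s * ∑ j, (V j : ℝ))))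
        ∂(Measure.pi fun _ : Fin t => ρ) ≤ 2 := by
  set P := Z * (Zᵀ * Z)⁻¹ * Zᵀ with hP
  set S := ∑ ℓ, ∑ k, P ℓ k ^ 2 with hS
  have hSs : S ≤ s := sum_sq_projection_le Z
  have hS0 : 0 ≤ S := by positivity
  have hs' : (0 : ℝ) < s := Nat.cast_pos.mpr hs
  let v : Fin t × Fin q → (Fin t → E) → ℝ := fun p e => ∑ k, P p.1 k * η p.2 (e k)
  have hF : ∀ e : Fin t → E, projSq Z (Matrix.of fun ℓ j => η j (e ℓ)) = ∑ p, v p e ^ 2 :=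
    fun e => projSq_eq _ _
  let a : Fin t × Fin q → ℝ := fun p => 4 * ((∑ k, P p.1 k ^ 2) * V p.2)
  have hasum : ∑ p, a p = 4 * S * ∑ j, (V j : ℝ) := by
    rw [Fintype.sum_prod_type, hS, mul_assoc, Finset.sum_mul_sum, Finset.mul_sum]
    exact Finset.sum_congr rfl fun ℓ _ => by rw [Finset.mul_sum]
  have hzero : ∀ p : Fin t × Fin q, (∑ k, P p.1 k ^ 2) = 0 → ∀ e, v p e = 0 := fun p hp e => by
    rw [Finset.sum_eq_zero_iff_of_nonneg fun _ _ => sq_nonneg _] at hp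
    refine Finset.sum_eq_zero fun k hk => ?_
    rw [pow_eq_zero_iff two_ne_zero |>.mp (hp k hk), zero_mul]
  simp_rw [hF]
  rcases hS0.eq_or_lt with hS0 | hS0
  · have hv0 : ∀ p e, v p e = 0 := fun p e => hzero p (by
      have := hS0.symm
      rw [hS, Finset.sum_eq_zero_iff_of_nonneg fun _ _ => by positivity] at this
      exact this p.1 (Finset.mem_univ _)) e
    simp [hv0]
  · have key := lintegral_exp_sum_sq_le (μ := Measure.pi fun _ : Fin t => ρ) Finset.univ
      (v := v) (a := a)
      (fun p _ => Finset.measurable_sum _ fun k _ =>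
        ((hη p.2).comp (measurable_pi_apply k)).const_mul _)
      (fun p _ => by positivity)
      (fun p _ hp => hzero p (by
        have := (hV p.2).ne'
        simpa [a, this] using hp))
      (fun p _ => by
        have hmp : Measurable (v p) := Finset.measurable_sum _ fun k _ =>
          ((hη p.2).comp (measurable_pi_apply k)).const_mul _
        rcases (show 0 ≤ ∑ k, P p.1 k ^ 2 by positivity).eq_or_lt with h0 | h0
        · simp [hzero p h0.symm]
        · have hsg := hasSubgaussianMGF_linear_combination (hη p.2) (h p.2) (P p.1)
          have hc : ((∑ k, ⟨P p.1 k ^ 2, sq_nonneg _⟩ * V p.2 : NNReal) : ℝ) =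
              (∑ k, P p.1 k ^ 2) * V p.2 := by
            rw [NNReal.coe_sum, Finset.sum_mul]
            rfl
          have := lintegral_exp_sq_le_of_hasSubgaussianMGF (V := ∑ k, ⟨P p.1 k ^ 2, sq_nonneg _⟩ * V p.2)
            (by
              rw [← NNReal.coe_pos, hc]
              exact mul_pos h0 (hV p.2)) hmp hsg
          rwa [hc] at this)
      (by rw [hasum]; positivity)
    refine le_trans (lintegral_mono fun e => ENNReal.ofReal_le_ofReal
      (Real.exp_le_exp.mpr ?_)) key
    rw [hasum]
    gcongr

theorem measurable_projSq_of {s t q : ℕ} :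
    Measurable fun y : (Fin t → Fin s → ℝ) × (Fin t → Fin q → ℝ) =>
      projSq (Matrix.of y.1) (Matrix.of y.2) := by
  have hZc : Continuous fun y : (Fin t → Fin s → ℝ) × (Fin t → Fin q → ℝ) =>
      (Matrix.of y.1 : Matrix (Fin t) (Fin s) ℝ) := continuous_fst
  have hWc : Continuous fun y : (Fin t → Fin s → ℝ) × (Fin t → Fin q → ℝ) =>
      (Matrix.of y.2 : Matrix (Fin t) (Fin q) ℝ) := continuous_snd
  have hN := hZc.matrix_transpose.matrix_mul hZc
  simp_rw [projSq_eq]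
  refine Finset.measurable_fun_sum _ fun p _ => Measurable.pow_const ?_ 2
  simp_rw [Matrix.inv_def, Ring.inverse_eq_inv', Matrix.mul_smul, Matrix.smul_mul,
    Matrix.smul_apply, smul_eq_mul]
  refine hN.matrix_det.measurable.inv.mul (Continuous.measurable ?_)
  exact (((hZc.matrix_mul hN.matrix_adjugate).matrix_mul hZc.matrix_transpose).matrix_mul
    hWc).matrix_elem _ _

theorem measurable_projSq {A : Type*} [MeasurableSpace A] {s t q : ℕ}
    {Z : A → Fin t → Fin s → ℝ} {W : A → Fin t → Fin q → ℝ}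
    (hZ : Measurable Z) (hW : Measurable W) :
    Measurable fun x => projSq (Matrix.of (Z x)) (Matrix.of (W x)) :=
  measurable_projSq_of.comp (hZ.prodMk hW)

theorem lintegral_of_indep_pairs {Ω D : Type*} [MeasurableSpace Ω] [MeasurableSpace D]
    {μ : Measure Ω} [IsProbabilityMeasure μ] {ν : Measure D} [IsProbabilityMeasure ν]
    {X : ℕ → Ω → D} {ε : ℕ → Ω → E} (hX : ∀ ℓ, Measurable (X ℓ)) (hε : ∀ ℓ, Measurable (ε ℓ))
    (hXν : ∀ ℓ, μ.map (X ℓ) = ν) (hερ : ∀ ℓ, μ.map (ε ℓ) = ρ)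
    (hXε : ∀ ℓ, IndepFun (X ℓ) (ε ℓ) μ) (hind : iIndepFun (fun ℓ ω => (X ℓ ω, ε ℓ ω)) μ)
    (t : ℕ) {G : (Fin t → D) × (Fin t → E) → ℝ≥0∞} (hG : Measurable G) :
    ∫⁻ ω, G (fun ℓ => X ℓ ω, fun ℓ => ε ℓ ω) ∂μ =
      ∫⁻ x, ∫⁻ e, G (x, e) ∂(Measure.pi fun _ => ρ) ∂(Measure.pi fun _ => ν) := by
  have hpair : ∀ ℓ, μ.map (fun ω => (X ℓ ω, ε ℓ ω)) = ν.prod ρ := fun ℓ => by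
    rw [(indepFun_iff_map_prod_eq_prod_map_map (hX ℓ).aemeasurable (hε ℓ).aemeasurable).mp (hXε ℓ),
      hXν, hερ]
  have hfin : iIndepFun (fun (ℓ : Fin t) ω => (X ℓ ω, ε ℓ ω)) μ :=
    hind.precomp (g := fun ℓ : Fin t => (ℓ : ℕ)) Fin.val_injective
  have hlaw : μ.map (fun ω (ℓ : Fin t) => (X ℓ ω, ε ℓ ω)) = Measure.pi fun _ => ν.prod ρ := by
    rw [(iIndepFun_iff_map_fun_eq_pi_map fun ℓ : Fin t =>
      ((hX ℓ).prodMk (hε ℓ)).aemeasurable).mp hfin]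
    simp_rw [hpair]
  have hmp := measurePreserving_arrowProdEquivProdArrow D E (Fin t) (fun _ => ν) (fun _ => ρ)
  have hm : Measurable fun ω (ℓ : Fin t) => (X ℓ ω, ε ℓ ω) :=
    measurable_pi_lambda _ fun ℓ => (hX ℓ).prodMk (hε ℓ)
  rw [← lintegral_prod _ hG.aemeasurable, ← hmp.map_eq, lintegral_map hG hmp.measurable, ← hlaw]
  exact (lintegral_map (hG.comp hmp.measurable) hm).symm

/-- Dimension-free tail bound for the projection of the noise onto the column space of the design. -/
theorem measure_projSq_ge_le {Ω : Type*} [MeasurableSpace Ω]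
    {μ : Measure Ω} [IsProbabilityMeasure μ] {s q : ℕ} (hs : 0 < s)
    {ν : Measure (EuclideanSpace ℝ (Fin s))} [IsProbabilityMeasure ν]
    {X : ℕ → Ω → EuclideanSpace ℝ (Fin s)} {ε : ℕ → Ω → E}
    (hX : ∀ ℓ, Measurable (X ℓ)) (hε : ∀ ℓ, Measurable (ε ℓ))
    (hXν : ∀ ℓ, μ.map (X ℓ) = ν) (hερ : ∀ ℓ, μ.map (ε ℓ) = ρ)
    (hXε : ∀ ℓ, IndepFun (X ℓ) (ε ℓ) μ) (hind : iIndepFun (fun ℓ ω => (X ℓ ω, ε ℓ ω)) μ)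
    {η : Fin q → E → ℝ} {V : Fin q → NNReal} (hη : ∀ j, Measurable (η j)) (hV : ∀ j, 0 < V j)
    (h : ∀ j, HasSubgaussianMGF (η j) (V j) ρ) (hVsum : 0 < ∑ j, (V j : ℝ))
    {t : ℕ} (ht : 0 < t) :
    μ.real {ω | 4 * s * (∑ j, (V j : ℝ)) * (3 * Real.log t) ≤
      projSq (dataMatrix (fun ℓ => X ℓ ω) t) (Matrix.of fun (ℓ : Fin t) j => η j (ε ℓ ω))} ≤
        2 / (t : ℝ) ^ 3 := by
  have ht' : (0 : ℝ) < t := Nat.cast_pos.mpr ht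
  have hs' : (0 : ℝ) < s := Nat.cast_pos.mpr hs
  set T := 4 * s * ∑ j, (V j : ℝ) with hT
  have hT0 : 0 < T := by positivity
  let G : (Fin t → EuclideanSpace ℝ (Fin s)) × (Fin t → E) → ℝ≥0∞ := fun y =>
    ENNReal.ofReal (Real.exp (projSq (Matrix.of fun (ℓ : Fin t) (i : Fin s) => y.1 ℓ i)
      (Matrix.of fun ℓ j => η j (y.2 ℓ)) / T))
  have hGm : Measurable G := by
    have h1 : Measurable fun (y : (Fin t → EuclideanSpace ℝ (Fin s)) × (Fin t → E)) (ℓ : Fin t)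
        (i : Fin s) => y.1 ℓ i := by fun_prop
    have h2 : Measurable fun (y : (Fin t → EuclideanSpace ℝ (Fin s)) × (Fin t → E)) (ℓ : Fin t)
        (j : Fin q) => η j (y.2 ℓ) := by fun_prop
    exact ((measurable_projSq h1 h2).div_const _).exp.ennreal_ofReal
  have hint : ∫⁻ ω, G (fun ℓ => X ℓ ω, fun ℓ => ε ℓ ω) ∂μ ≤ 2 := by
    rw [lintegral_of_indep_pairs hX hε hXν hερ hXε hind t hGm]
    calc _ ≤ ∫⁻ _, 2 ∂(Measure.pi fun _ : Fin t => ν) := lintegral_mono fun x =>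
          lintegral_exp_projSq_le hs (Matrix.of fun ℓ i => x ℓ i) hη hV h hVsum
      _ = 2 := by simp
  have hGm' : Measurable fun ω => G (fun ℓ => X ℓ ω, fun ℓ => ε ℓ ω) :=
    hGm.comp ((measurable_pi_lambda _ fun ℓ : Fin t => hX ℓ).prodMk
      (measurable_pi_lambda _ fun ℓ : Fin t => hε ℓ))
  have hsub : {ω | T * (3 * Real.log t) ≤
      projSq (dataMatrix (fun ℓ => X ℓ ω) t) (Matrix.of fun (ℓ : Fin t) j => η j (ε ℓ ω))} ⊆
      {ω | ENNReal.ofReal ((t : ℝ) ^ 3) ≤ G (fun ℓ => X ℓ ω, fun ℓ => ε ℓ ω)} := fun ω hω => by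
    refine ENNReal.ofReal_le_ofReal ?_
    have e : (t : ℝ) ^ 3 = Real.exp (3 * Real.log t) := by
      rw [mul_comm, Real.exp_mul, Real.exp_log ht']
      norm_cast
    rw [e, Real.exp_le_exp, le_div_iff₀' hT0]
    exact hω
  have hmk := meas_ge_le_lintegral_div (μ := μ) hGm'.aemeasurable
    (ε := ENNReal.ofReal ((t : ℝ) ^ 3)) (ENNReal.ofReal_pos.mpr (pow_pos ht' 3)).ne' ENNReal.ofReal_ne_top
  refine ENNReal.toReal_le_of_le_ofReal (by positivity) ?_
  refine (measure_mono hsub).trans (hmk.trans ?_)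
  rw [ENNReal.ofReal_div_of_pos (by positivity), ENNReal.ofReal_ofNat]
  gcongr

end noise

section deterministic

theorem abs_dotProduct_mulVec_le {s : ℕ} {D : Matrix (Fin s) (Fin s) ℝ} {δ : ℝ}
    (hD : ∀ i j, |D i j| ≤ δ) (x : Fin s → ℝ) :
    |x ⬝ᵥ D *ᵥ x| ≤ s * δ * (x ⬝ᵥ x) := by
  rcases Nat.eq_zero_or_pos s with rfl | hs
  · simp
  have hδ : 0 ≤ δ := (abs_nonneg _).trans (hD ⟨0, hs⟩ ⟨0, hs⟩)
  have h1 : |x ⬝ᵥ D *ᵥ x| ≤ ∑ i, |x i| * ∑ j, δ * |x j| := by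
    refine (Finset.abs_sum_le_sum_abs _ _).trans (Finset.sum_le_sum fun i _ => ?_)
    rw [abs_mul]
    refine mul_le_mul_of_nonneg_left ?_ (abs_nonneg _)
    refine (Finset.abs_sum_le_sum_abs (fun j => D i j * x j) Finset.univ).trans
      (Finset.sum_le_sum fun j _ => ?_)
    rw [abs_mul]
    exact mul_le_mul_of_nonneg_right (hD i j) (abs_nonneg _)
  have h2 : ∑ i, |x i| * ∑ j, δ * |x j| = δ * (∑ i, |x i|) ^ 2 := by
    rw [← Finset.mul_sum, ← Finset.sum_mul]
    ring
  have h3 : (∑ i, |x i|) ^ 2 ≤ s * (x ⬝ᵥ x) := by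
    have := sq_sum_le_card_mul_sum_sq (s := Finset.univ) (f := fun i => |x i|)
    simpa [dotProduct, ← sq] using this
  calc _ ≤ δ * (∑ i, |x i|) ^ 2 := h1.trans_eq h2
    _ ≤ δ * (s * (x ⬝ᵥ x)) := by gcongr
    _ = _ := by ring

variable {s k q : ℕ} (Q : Matrix (Fin q) (Fin k) ℝ) (β : Matrix (Fin k) (Fin s) ℝ)

theorem riskTrace_eq_sum (S : Matrix (Fin s) (Fin s) ℝ) :
    riskTrace Q S β = ∑ j, (Q * β) j ⬝ᵥ S *ᵥ (Q * β) j := by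
  have : riskTrace Q S β = ((Q * β) * (S * (Q * β)ᵀ)).trace := by
    rw [riskTrace, Matrix.trace_mul_comm (Q * β), Matrix.transpose_mul]
    simp only [Matrix.mul_assoc]
  rw [this]
  simp only [Matrix.trace, Matrix.diag, Matrix.mul_apply (M := Q * β), dotProduct]
  rfl

theorem trace_coeff_eq_sum :
    (Q * β * βᵀ * Qᵀ).trace = ∑ j, (Q * β) j ⬝ᵥ (Q * β) j := by
  have : Q * β * βᵀ * Qᵀ = (Q * β) * (Q * β)ᵀ := by
    rw [Matrix.transpose_mul, Matrix.mul_assoc]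
  rw [this]
  simp only [Matrix.trace, Matrix.diag, Matrix.mul_apply (M := Q * β), dotProduct]
  rfl

theorem abs_riskTrace_le {S : Matrix (Fin s) (Fin s) ℝ} {δ : ℝ} (hS : ∀ i j, |S i j| ≤ δ) :
    |riskTrace Q S β| ≤ s * δ * (Q * β * βᵀ * Qᵀ).trace := by
  rw [riskTrace_eq_sum, trace_coeff_eq_sum, Finset.mul_sum]
  exact (Finset.abs_sum_le_sum_abs _ _).trans
    (Finset.sum_le_sum fun j _ => abs_dotProduct_mulVec_le hS _)

theorem riskTrace_sub (S S' : Matrix (Fin s) (Fin s) ℝ) :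
    riskTrace Q (S - S') β = riskTrace Q S β - riskTrace Q S' β := by
  simp only [riskTrace, Matrix.sub_mul, Matrix.trace_sub]

theorem dotProduct_mulVec_le_specNorm (A : Matrix (Fin s) (Fin s) ℝ) (x : Fin s → ℝ) :
    x ⬝ᵥ A *ᵥ x ≤ specNorm A * (x ⬝ᵥ x) := by
  set y : EuclideanSpace ℝ (Fin s) := WithLp.toLp 2 x
  have h1 : x ⬝ᵥ A *ᵥ x = inner ℝ (Matrix.toEuclideanCLM (n := Fin s) (𝕜 := ℝ) A y) y := by
    simp [y, PiLp.inner_apply, dotProduct]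
  have h2 : x ⬝ᵥ x = ‖y‖ * ‖y‖ := by
    rw [← real_inner_self_eq_norm_mul_norm]
    simp only [y, PiLp.inner_apply, dotProduct]
    rfl
  rw [h1, h2, specNorm, ← mul_assoc]
  exact (real_inner_le_norm _ _).trans
    (mul_le_mul_of_nonneg_right (ContinuousLinearMap.le_opNorm _ _) (norm_nonneg _))

theorem specNorm_nonneg (A : Matrix (Fin s) (Fin s) ℝ) : 0 ≤ specNorm A := norm_nonneg _

theorem dotProduct_self_le_specNorm_inv {S : Matrix (Fin s) (Fin s) ℝ} (hS : Sᵀ = S)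
    (hpos : ∀ x, 0 ≤ x ⬝ᵥ S *ᵥ x) (hdet : S.det ≠ 0) (x : Fin s → ℝ) :
    x ⬝ᵥ x ≤ specNorm S⁻¹ * (x ⬝ᵥ S *ᵥ x) := by
  have hu : IsUnit S.det := isUnit_iff_ne_zero.mpr hdet
  have hSy : S *ᵥ (S⁻¹ *ᵥ x) = x := by
    rw [Matrix.mulVec_mulVec, Matrix.mul_nonsing_inv _ hu, Matrix.one_mulVec]
  have hcross : (S⁻¹ *ᵥ x) ⬝ᵥ S *ᵥ x = x ⬝ᵥ x := by
    rw [Matrix.dotProduct_mulVec, ← Matrix.mulVec_transpose, hS, hSy]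
  have hyy : (S⁻¹ *ᵥ x) ⬝ᵥ x = x ⬝ᵥ S⁻¹ *ᵥ x := dotProduct_comm _ _
  set n := specNorm S⁻¹ with hn
  have hn0 : 0 ≤ n := specNorm_nonneg _
  have hle : x ⬝ᵥ S⁻¹ *ᵥ x ≤ n * (x ⬝ᵥ x) := dotProduct_mulVec_le_specNorm _ _
  have hquad := hpos (n • x - S⁻¹ *ᵥ x)
  have hexp : (n • x - S⁻¹ *ᵥ x) ⬝ᵥ S *ᵥ (n • x - S⁻¹ *ᵥ x) =
      n ^ 2 * (x ⬝ᵥ S *ᵥ x) - 2 * n * (x ⬝ᵥ x) + x ⬝ᵥ S⁻¹ *ᵥ x := by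
    rw [Matrix.mulVec_sub, Matrix.mulVec_smul, hSy]
    simp only [sub_dotProduct, dotProduct_sub, smul_dotProduct, dotProduct_smul, smul_eq_mul,
      hcross, hyy]
    ring
  rw [hexp] at hquad
  have hx0 : 0 ≤ x ⬝ᵥ x := by simpa using dotProduct_self_star_nonneg x
  rcases hn0.eq_or_lt with h0 | h0
  · have h1 : S⁻¹ = 0 := by
      have : Matrix.toEuclideanCLM (n := Fin s) (𝕜 := ℝ) S⁻¹ = 0 := norm_eq_zero.mp h0.symm
      simpa using this
    have : x = 0 := by rw [← hSy, h1]; simp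
    simp [this]
  · have : 0 ≤ n * (n * (x ⬝ᵥ S *ᵥ x) - x ⬝ᵥ x) := by nlinarith
    have := nonneg_of_mul_nonneg_right this h0
    linarith

theorem trace_coeff_le_specNorm_inv_mul_riskTrace {S : Matrix (Fin s) (Fin s) ℝ} (hS : Sᵀ = S)
    (hpos : ∀ x, 0 ≤ x ⬝ᵥ S *ᵥ x) (hdet : S.det ≠ 0) :
    (Q * β * βᵀ * Qᵀ).trace ≤ specNorm S⁻¹ * riskTrace Q S β := by
  rw [riskTrace_eq_sum, trace_coeff_eq_sum, Finset.mul_sum]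
  exact Finset.sum_le_sum fun j _ => dotProduct_self_le_specNorm_inv hS hpos hdet _

theorem sum_sub_mean_sq_le {t : ℕ} (ht : 0 < t) (a : Fin t → ℝ) :
    ∑ ℓ, (a ℓ - 1 / (t : ℝ) * ∑ m, a m) ^ 2 ≤ ∑ ℓ, a ℓ ^ 2 := by
  have ht' : (t : ℝ) ≠ 0 := by positivity
  set A := ∑ m, a m with hA
  have : ∑ ℓ, (a ℓ - 1 / (t : ℝ) * A) ^ 2 = ∑ ℓ, a ℓ ^ 2 - 1 / t * A ^ 2 := by
    have e : ∀ ℓ, (a ℓ - 1 / (t : ℝ) * A) ^ 2 =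
        a ℓ ^ 2 - 2 * (1 / (t : ℝ) * A) * a ℓ + (1 / (t : ℝ) * A) ^ 2 := fun ℓ => by ring
    simp_rw [e, Finset.sum_add_distrib, Finset.sum_sub_distrib, ← Finset.mul_sum, ← hA]
    simp only [Finset.sum_const, Finset.card_univ, Fintype.card_fin, nsmul_eq_mul]
    field_simp
    ring
  rw [this]
  have : 0 ≤ 1 / (t : ℝ) * A ^ 2 := by positivity
  linarith

theorem abs_sum_add_sq_sub_le {ι : Type*} (J : Finset ι) (a d : ι → ℝ) :
    |∑ i ∈ J, (a i + d i) ^ 2 - ∑ i ∈ J, a i ^ 2| ≤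
      2 * √((∑ i ∈ J, a i ^ 2) * ∑ i ∈ J, d i ^ 2) + ∑ i ∈ J, d i ^ 2 := by
  have h1 : |∑ i ∈ J, a i * d i| ≤ √((∑ i ∈ J, a i ^ 2) * ∑ i ∈ J, d i ^ 2) :=
    Real.abs_le_sqrt (Finset.sum_mul_sq_le_sq_mul_sq J a d)
  have h2 : ∑ i ∈ J, (a i + d i) ^ 2 - ∑ i ∈ J, a i ^ 2 =
      2 * ∑ i ∈ J, a i * d i + ∑ i ∈ J, d i ^ 2 := by
    rw [← Finset.sum_sub_distrib, Finset.mul_sum, ← Finset.sum_add_distrib]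
    exact Finset.sum_congr rfl fun i _ => by ring
  have h3 : 0 ≤ ∑ i ∈ J, d i ^ 2 := Finset.sum_nonneg fun _ _ => sq_nonneg _
  rw [h2]
  refine (abs_add_le _ _).trans ?_
  rw [abs_mul, abs_two, abs_of_nonneg h3]
  linarith

variable (x : ℕ → EuclideanSpace ℝ (Fin s)) (t : ℕ)

theorem meanHat_apply (i : Fin s) :
    meanHat x t i = 1 / (t : ℝ) * ∑ ℓ ∈ Finset.range t, x ℓ i := by
  simp [meanHat]

theorem sigmaHat_apply (i j : Fin s) :
    sigmaHat x t i j = 1 / ((t : ℝ) - 1) * ∑ ℓ ∈ Finset.range t,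
      (x ℓ i - meanHat x t i) * (x ℓ j - meanHat x t j) := by
  simp [sigmaHat, Matrix.sum_apply, Matrix.vecMulVec_apply]

theorem dotProduct_sigmaHat_mulVec (v : Fin s → ℝ) :
    v ⬝ᵥ sigmaHat x t *ᵥ v = 1 / ((t : ℝ) - 1) * ∑ ℓ : Fin t,
      ((dataMatrix x t *ᵥ v) ℓ - 1 / (t : ℝ) * ∑ m, (dataMatrix x t *ᵥ v) m) ^ 2 := by
  have hc : ∀ ℓ : Fin t, (dataMatrix x t *ᵥ v) ℓ - 1 / (t : ℝ) * ∑ m, (dataMatrix x t *ᵥ v) m =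
      ∑ i, (x ℓ i - meanHat x t i) * v i := fun ℓ => by
    simp only [Matrix.mulVec, dotProduct, dataMatrix, Matrix.of_apply, sub_mul,
      Finset.sum_sub_distrib, meanHat_apply, Finset.sum_range]
    congr 1
    rw [Finset.sum_comm, Finset.mul_sum]
    exact Finset.sum_congr rfl fun i _ => by rw [← Finset.sum_mul, mul_assoc]
  simp_rw [hc]
  simp only [Matrix.mulVec, dotProduct, sigmaHat_apply, Finset.sum_range, Finset.mul_sum, sq,
    Finset.sum_mul]
  rw [Finset.sum_comm]
  simp_rw [Finset.sum_comm (γ := Fin t)]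
  rw [Finset.sum_comm]
  refine Finset.sum_congr rfl fun a _ => Finset.sum_congr rfl fun b _ =>
    Finset.sum_congr rfl fun c _ => ?_
  ring

theorem rank_dataMatrix_of_det_ne_zero (h : ((dataMatrix x t)ᵀ * dataMatrix x t).det ≠ 0) :
    (dataMatrix x t).rank = s := by
  rw [← Matrix.rank_transpose_mul_self, Matrix.rank_of_isUnit _
    ((Matrix.isUnit_iff_isUnit_det _).mpr (isUnit_iff_ne_zero.mpr h)), Fintype.card_fin]

theorem det_gram_ne_zero {S : Matrix (Fin s) (Fin s) ℝ} (hS : Sᵀ = S)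
    (hpos : ∀ x, 0 ≤ x ⬝ᵥ S *ᵥ x) (hdet : S.det ≠ 0) {δ : ℝ}
    (hδ : ∀ i j, |sigmaHat x t i j - S i j| ≤ δ) (hsmall : specNorm S⁻¹ * (s * δ) < 1) :
    ((dataMatrix x t)ᵀ * dataMatrix x t).det ≠ 0 := by
  intro h0
  obtain ⟨v, hv, hv0⟩ := Matrix.exists_mulVec_eq_zero_iff.mpr h0
  have hZv : dataMatrix x t *ᵥ v = 0 := by
    rw [← dotProduct_self_eq_zero, Matrix.dotProduct_mulVec, ← Matrix.mulVec_transpose,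
      Matrix.mulVec_mulVec, hv0, zero_dotProduct]
  have hsig : v ⬝ᵥ sigmaHat x t *ᵥ v = 0 := by
    rw [dotProduct_sigmaHat_mulVec, hZv]
    simp
  have h1 := abs_dotProduct_mulVec_le (D := sigmaHat x t - S) hδ v
  rw [Matrix.sub_mulVec, dotProduct_sub, hsig, zero_sub, abs_neg, abs_of_nonneg (hpos v)] at h1
  have h2 := dotProduct_self_le_specNorm_inv hS hpos hdet v
  have h3 : 0 < v ⬝ᵥ v := by
    have := dotProduct_self_star_nonneg v
    simp only [star_trivial] at this
    exact lt_of_le_of_ne this fun h => hv (dotProduct_self_eq_zero.mp h.symm)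
  have h4 := mul_le_mul_of_nonneg_left h1 (specNorm_nonneg S⁻¹)
  nlinarith

theorem riskTrace_sigmaHat :
    riskTrace Q (sigmaHat x t) β = 1 / ((t : ℝ) - 1) * ∑ p : Fin t × Fin q,
      ((dataMatrix x t * (Q * β)ᵀ) p.1 p.2 -
        1 / (t : ℝ) * ∑ m, (dataMatrix x t * (Q * β)ᵀ) m p.2) ^ 2 := by
  rw [riskTrace_eq_sum, Fintype.sum_prod_type_right, Finset.mul_sum]
  exact Finset.sum_congr rfl fun j _ => dotProduct_sigmaHat_mulVec x t _

theorem abs_riskTrace_betaHat_sub_le (ht : 2 ≤ t)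
    (hdet : ((dataMatrix x t)ᵀ * dataMatrix x t).det ≠ 0)
    {y ε : ℕ → EuclideanSpace ℝ (Fin k)}
    (hy : ∀ ℓ, y ℓ = WithLp.toLp 2 (β *ᵥ (x ℓ).ofLp) + ε ℓ) :
    |riskTrace Q (sigmaHat x t) (betaHat x y t) - riskTrace Q (sigmaHat x t) β| ≤
      1 / ((t : ℝ) - 1) * (2 * √(((t : ℝ) - 1) * riskTrace Q (sigmaHat x t) β *
        projSq (dataMatrix x t) (dataMatrix ε t * Qᵀ)) +
        projSq (dataMatrix x t) (dataMatrix ε t * Qᵀ)) := by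
  have ht1 : (0 : ℝ) < (t : ℝ) - 1 := by
    have : (2 : ℝ) ≤ t := by exact_mod_cast ht
    linarith
  set Z := dataMatrix x t with hZ
  set W := dataMatrix ε t * Qᵀ with hW
  set R := Z * (Zᵀ * Z)⁻¹ * Zᵀ * W with hR
  have hYd : dataMatrix y t = Z * βᵀ + dataMatrix ε t := by
    ext ℓ j
    simp [dataMatrix, hZ, hy, Matrix.mul_apply, Matrix.mulVec, dotProduct, mul_comm]
  have hfit : Z * (Q * betaHat x y t)ᵀ = Z * (Q * β)ᵀ + R := by
    have hb : (betaHat x y t)ᵀ = βᵀ + (Zᵀ * Z)⁻¹ * Zᵀ * dataMatrix ε t := by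
      rw [betaHat, Matrix.transpose_transpose, hYd, Matrix.mul_add, ← Matrix.mul_assoc,
        Matrix.mul_assoc _ Zᵀ Z, Matrix.nonsing_inv_mul _ (isUnit_iff_ne_zero.mpr hdet),
        Matrix.one_mul]
    rw [Matrix.transpose_mul, hb, Matrix.transpose_mul, Matrix.add_mul, Matrix.mul_add, hR, hW]
    simp only [Matrix.mul_assoc]
  let a : Fin t × Fin q → ℝ := fun p =>
    (Z * (Q * β)ᵀ) p.1 p.2 - 1 / (t : ℝ) * ∑ m, (Z * (Q * β)ᵀ) m p.2
  let d : Fin t × Fin q → ℝ := fun p => R p.1 p.2 - 1 / (t : ℝ) * ∑ m, R m p.2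
  have ha : riskTrace Q (sigmaHat x t) β = 1 / ((t : ℝ) - 1) * ∑ p, a p ^ 2 :=
    riskTrace_sigmaHat Q β x t
  have had : riskTrace Q (sigmaHat x t) (betaHat x y t) =
      1 / ((t : ℝ) - 1) * ∑ p, (a p + d p) ^ 2 := by
    rw [riskTrace_sigmaHat, ← hZ, hfit]
    congr 1
    refine Finset.sum_congr rfl fun p _ => ?_
    simp only [a, d, Matrix.add_apply, Finset.sum_add_distrib]
    ring
  have hd : ∑ p, d p ^ 2 ≤ projSq Z W := by
    rw [projSq_eq, Fintype.sum_prod_type_right, Fintype.sum_prod_type_right]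
    exact Finset.sum_le_sum fun j _ => sum_sub_mean_sq_le (by omega) fun ℓ => R ℓ j
  have hasq : ((t : ℝ) - 1) * riskTrace Q (sigmaHat x t) β = ∑ p, a p ^ 2 := by
    rw [ha]
    field_simp
  rw [hasq, had, ha, ← mul_sub, abs_mul, abs_of_pos (by positivity : 0 < 1 / ((t : ℝ) - 1))]
  refine mul_le_mul_of_nonneg_left ((abs_sum_add_sq_sub_le _ a d).trans ?_) (by positivity)
  have : 0 ≤ ∑ p, a p ^ 2 := Finset.sum_nonneg fun _ _ => sq_nonneg _
  gcongr

end deterministic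

section covariance

variable {d : ℕ} {ν : Measure (EuclideanSpace ℝ (Fin d))} [IsProbabilityMeasure ν]

theorem covMatrix_transpose (ν : Measure (EuclideanSpace ℝ (Fin d))) :
    (covMatrix ν)ᵀ = covMatrix ν := by
  ext i j
  exact covariance_comm _ _

theorem dotProduct_covMatrix_mulVec (h : ∀ i, MemLp (fun x : EuclideanSpace ℝ (Fin d) => x i) 2 ν)
    (v : Fin d → ℝ) : v ⬝ᵥ covMatrix ν *ᵥ v = Var[fun x => ∑ i, v i * x i; ν] := by
  rw [← covariance_self (Finset.aemeasurable_fun_sum _ fun i _ =>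
      (h i).aestronglyMeasurable.aemeasurable.const_mul _),
    covariance_fun_sum_fun_sum (fun i => (h i).const_mul _) fun i => (h i).const_mul _]
  simp only [dotProduct, Matrix.mulVec, covMatrix, Matrix.of_apply, covariance_const_mul_left,
    covariance_const_mul_right, Finset.mul_sum]
  exact Finset.sum_congr rfl fun i _ => Finset.sum_congr rfl fun j _ => by ring

theorem covMatrix_quadratic_nonneg
    (h : ∀ i, MemLp (fun x : EuclideanSpace ℝ (Fin d) => x i) 2 ν)
    (v : Fin d → ℝ) : 0 ≤ v ⬝ᵥ covMatrix ν *ᵥ v := by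
  rw [dotProduct_covMatrix_mulVec h]
  exact variance_nonneg _ _

end covariance

section regressors

variable {s : ℕ} {ν : Measure (EuclideanSpace ℝ (Fin s))} {K : ℝ}

theorem lintegral_exp_norm_sq_le (hK : 1 ≤ K)
    (h : orliczNorm 2 (fun x => ‖x‖) ν ≤ ENNReal.ofReal K) :
    ∫⁻ x, ENNReal.ofReal (Real.exp (‖x‖ ^ 2 / (4 * K ^ 2))) ∂ν ≤ 2 := by
  have := lintegral_exp_sq_le_two_of_orliczNorm_lt (c := 2 * K)
    (h.trans_lt ((ENNReal.ofReal_lt_ofReal_iff (by linarith)).mpr (by linarith)))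
  rw [mul_pow] at this
  norm_num at this
  exact this

theorem lintegral_exp_coord_mul_le (hK : 1 ≤ K)
    (h : orliczNorm 2 (fun x => ‖x‖) ν ≤ ENNReal.ofReal K) (i j : Fin s) :
    ∫⁻ x, ENNReal.ofReal (Real.exp (|x i * x j| / (4 * K ^ 2))) ∂ν ≤ 4 := by
  refine (lintegral_mono fun x => ENNReal.ofReal_le_ofReal (Real.exp_le_exp.mpr ?_)).trans
    ((lintegral_exp_norm_sq_le hK h).trans (by norm_num))
  have : |x i * x j| ≤ ‖x‖ ^ 2 := by
    rw [abs_mul, sq]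
    exact mul_le_mul (PiLp.norm_apply_le x i) (PiLp.norm_apply_le x j) (abs_nonneg _)
      (norm_nonneg _)
  gcongr

theorem lintegral_exp_coord_le (hK : 1 ≤ K)
    (h : orliczNorm 2 (fun x => ‖x‖) ν ≤ ENNReal.ofReal K) (i : Fin s) :
    ∫⁻ x, ENNReal.ofReal (Real.exp (|x i| / (4 * K ^ 2))) ∂ν ≤ 4 := by
  have hpt : ∀ x : EuclideanSpace ℝ (Fin s), Real.exp (|x i| / (4 * K ^ 2)) ≤
      2 * Real.exp (‖x‖ ^ 2 / (4 * K ^ 2)) := fun x => by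
    have h1 : |x i| ≤ ‖x‖ ^ 2 + 1 / 4 := by
      have : |x i| ≤ ‖x‖ := PiLp.norm_apply_le x i
      nlinarith [sq_nonneg (‖x‖ - 1 / 2)]
    have h2 : Real.exp (1 / 2 * 1) ≤ 2 := by
      have := exp_mul_le_one_add (p := 1 / 2) (z := 1) (by norm_num) (by norm_num)
      linarith [Real.exp_one_lt_d9]
    calc Real.exp (|x i| / (4 * K ^ 2)) ≤ Real.exp (1 / 2 * 1 + ‖x‖ ^ 2 / (4 * K ^ 2)) := by
          rw [Real.exp_le_exp, div_le_iff₀ (by positivity), add_mul, div_mul_cancel₀ _ (by positivity)]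
          nlinarith
      _ ≤ _ := by
          rw [Real.exp_add]
          gcongr
  calc _ ≤ ∫⁻ x : EuclideanSpace ℝ (Fin s),
        2 * ENNReal.ofReal (Real.exp (‖x‖ ^ 2 / (4 * K ^ 2))) ∂ν :=
        lintegral_mono fun x => (ENNReal.ofReal_le_ofReal (hpt x)).trans_eq (by
          rw [ENNReal.ofReal_mul (by norm_num), ENNReal.ofReal_ofNat])
    _ ≤ 2 * 2 := by
        rw [lintegral_const_mul _ (by fun_prop)]
        gcongr
        exact lintegral_exp_norm_sq_le hK h
    _ = 4 := by norm_num

theorem memLp_two_coord (hK : 1 ≤ K)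
    (h : orliczNorm 2 (fun x => ‖x‖) ν ≤ ENNReal.ofReal K) (i : Fin s) :
    MemLp (fun x : EuclideanSpace ℝ (Fin s) => x i) 2 ν := by
  rw [memLp_two_iff_integrable_sq (by fun_prop)]
  have := (abs_integral_le_of_lintegral_exp_abs (by positivity) (by fun_prop)
    (lintegral_exp_coord_mul_le hK h i i)).1
  simpa [sq] using this

theorem sigmaHat_apply_eq (x : ℕ → EuclideanSpace ℝ (Fin s)) {t : ℕ} (ht : 0 < t) (i j : Fin s) :
    sigmaHat x t i j = t / ((t : ℝ) - 1) *
      (1 / (t : ℝ) * (∑ ℓ ∈ Finset.range t, x ℓ i * x ℓ j) -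
        (1 / (t : ℝ) * ∑ ℓ ∈ Finset.range t, x ℓ i) *
          (1 / (t : ℝ) * ∑ ℓ ∈ Finset.range t, x ℓ j)) := by
  have ht' : (t : ℝ) ≠ 0 := by positivity
  rw [sigmaHat_apply, meanHat_apply, meanHat_apply]
  set A := ∑ ℓ ∈ Finset.range t, x ℓ i
  set B := ∑ ℓ ∈ Finset.range t, x ℓ j
  have e : ∀ ℓ, (x ℓ i - 1 / (t : ℝ) * A) * (x ℓ j - 1 / (t : ℝ) * B) =
      x ℓ i * x ℓ j - (1 / (t : ℝ) * B) * x ℓ i - (1 / (t : ℝ) * A) * x ℓ j +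
        (1 / (t : ℝ) * A) * (1 / (t : ℝ) * B) := fun ℓ => by ring
  simp_rw [e, Finset.sum_add_distrib, Finset.sum_sub_distrib, ← Finset.mul_sum]
  simp only [Finset.sum_const, Finset.card_range, nsmul_eq_mul]
  change 1 / ((t : ℝ) - 1) * (_ - 1 / (t : ℝ) * B * A - 1 / (t : ℝ) * A * B + _) = _
  field_simp
  ring

theorem abs_sample_covariance_sub_le {κ r t P A x y m n : ℝ} (hκ : 1 ≤ κ) (hr : 0 ≤ r)
    (hr2 : r ≤ 1 / 2) (ht : 2 ≤ t) (htr : 1 / t ≤ r) (hA : |A| ≤ 4 * κ) (hm : |m| ≤ 4 * κ)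
    (hn : |n| ≤ 4 * κ) (hP : |P - A| ≤ 35 * κ * r) (hx : |x - m| ≤ 35 * κ * r)
    (hy : |y - n| ≤ 35 * κ * r) :
    |t / (t - 1) * (P - x * y) - (A - m * n)| ≤ 2000 * κ ^ 2 * r := by
  have ht1 : 0 < t - 1 := by linarith
  have hinv : 1 / (t - 1) ≤ 2 * r := by
    have : 1 / (t - 1) ≤ 2 * (1 / t) := by
      rw [div_le_iff₀ ht1]
      field_simp
      linarith
    linarith
  have hfac : t / (t - 1) ≤ 2 := by
    rw [div_le_iff₀ ht1]
    linarith
  have hfac0 : 0 ≤ t / (t - 1) := by positivity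
  have e : t / (t - 1) * (P - x * y) - (A - m * n) =
      t / (t - 1) * ((P - A) - ((x - m) * (y - n) + (x - m) * n + m * (y - n))) +
        1 / (t - 1) * (A - m * n) := by
    field_simp
    ring
  have hκr : κ * r ≤ κ ^ 2 * r := mul_le_mul_of_nonneg_right (by nlinarith) hr
  have hb0 : 0 ≤ 35 * κ * r := by positivity
  have hk0 : 0 ≤ 4 * κ := by positivity
  have b1 : |(x - m) * (y - n)| ≤ 613 * (κ ^ 2 * r) := by
    rw [abs_mul]
    have := mul_le_mul hx hy (abs_nonneg _) hb0
    have h2 : κ ^ 2 * r * r ≤ κ ^ 2 * r * (1 / 2) := by gcongr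
    nlinarith
  have b2 : |(x - m) * n| ≤ 140 * (κ ^ 2 * r) := by
    rw [abs_mul]
    have := mul_le_mul hx hn (abs_nonneg _) hb0
    nlinarith
  have b3 : |m * (y - n)| ≤ 140 * (κ ^ 2 * r) := by
    rw [abs_mul]
    have := mul_le_mul hm hy (abs_nonneg _) hk0
    nlinarith
  have b4 : |A - m * n| ≤ 20 * κ ^ 2 := by
    have h1 := abs_sub A (m * n)
    have h2 := mul_le_mul hm hn (abs_nonneg _) hk0
    rw [abs_mul] at h1
    nlinarith
  have b5 : |(P - A) - ((x - m) * (y - n) + (x - m) * n + m * (y - n))| ≤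
      928 * (κ ^ 2 * r) := by
    have h1 := abs_sub (P - A) ((x - m) * (y - n) + (x - m) * n + m * (y - n))
    have h2 := abs_add_three ((x - m) * (y - n)) ((x - m) * n) (m * (y - n))
    linarith
  rw [e]
  refine (abs_add_le _ _).trans ?_
  rw [abs_mul, abs_mul, abs_of_nonneg hfac0, abs_of_pos (by positivity : 0 < 1 / (t - 1))]
  have c1 := mul_le_mul hfac b5 (abs_nonneg _) (by norm_num)
  have c2 := mul_le_mul hinv b4 (abs_nonneg _) (by positivity)
  nlinarith [mul_nonneg (sq_nonneg κ) hr]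

end regressors

section noise

variable {k q : ℕ} {ρ : Measure (EuclideanSpace ℝ (Fin k))} {M : ℝ}

theorem inner_toLp_eq (e : EuclideanSpace ℝ (Fin k)) (w : Fin k → ℝ) :
    inner ℝ e (WithLp.toLp 2 w) = ∑ a, e a * w a := by
  simp [PiLp.inner_apply, mul_comm]

theorem memLp_two_of_orliczNorm_ne_top {η : EuclideanSpace ℝ (Fin k) → ℝ} (hη : Measurable η)
    (h : orliczNorm 2 η ρ ≠ ⊤) : MemLp η 2 ρ := by
  obtain ⟨c, hc, hlt⟩ : ∃ c : ℝ, 0 < c ∧ orliczNorm 2 η ρ < ENNReal.ofReal c := by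
    refine ⟨(orliczNorm 2 η ρ).toReal + 1, by positivity, ?_⟩
    rw [ENNReal.lt_ofReal_iff_toReal_lt h]
    linarith
  have h2 := lintegral_exp_sq_le_two_of_orliczNorm_lt hlt
  rw [memLp_two_iff_integrable_sq hη.aestronglyMeasurable]
  refine (abs_integral_le_of_lintegral_exp_abs (κ := c ^ 2) (by positivity)
    (hη.pow_const 2).aemeasurable ?_).1
  simp_rw [abs_sq]
  exact h2.trans (by norm_num)

/-- The variance proxies of the coordinates of `Q ε`. -/
theorem noise_hasSubgaussianMGF [IsProbabilityMeasure ρ] (hM : 0 < M) (h0 : ∫ e, e ∂ρ = 0)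
    (h : ∀ θ : EuclideanSpace ℝ (Fin k),
      orliczNorm 2 (fun e => inner ℝ e θ) ρ ≠ ⊤ ∧
      orliczNorm 2 (fun e => inner ℝ e θ) ρ ≤
        ENNReal.ofReal M * eLpNorm (fun e => inner ℝ e θ) 2 ρ)
    {δ : ℝ} (hδ : 0 < δ) (w : Fin k → ℝ) :
    HasSubgaussianMGF (fun e : EuclideanSpace ℝ (Fin k) => ∑ a, e a * w a)
      (2 * (M * √(w ⬝ᵥ covMatrix ρ *ᵥ w) + δ) ^ 2).toNNReal ρ := by
  have hcoord : ∀ i, MemLp (fun e : EuclideanSpace ℝ (Fin k) => e i) 2 ρ := fun i => by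
    have := memLp_two_of_orliczNorm_ne_top (by fun_prop) (h (EuclideanSpace.single i 1)).1
    simpa [EuclideanSpace.inner_single_right] using this
  have hint : Integrable (fun e : EuclideanSpace ℝ (Fin k) => e) ρ :=
    Integrable.of_eval_piLp fun i => (hcoord i).integrable (by norm_num)
  set η : EuclideanSpace ℝ (Fin k) → ℝ := fun e => ∑ a, e a * w a with hη
  have hηi : (fun e : EuclideanSpace ℝ (Fin k) => inner ℝ e (WithLp.toLp 2 w)) = η :=
    funext fun e => inner_toLp_eq e w
  have hηm : Measurable η := by fun_prop
  have hor := h (WithLp.toLp 2 w)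
  rw [hηi] at hor
  have hL2 := memLp_two_of_orliczNorm_ne_top hηm hor.1
  have hmean : ∫ e, η e ∂ρ = 0 := by
    have hη' : η = fun e => inner ℝ (WithLp.toLp 2 w) e := by
      rw [← hηi]
      exact funext fun e => real_inner_comm _ _
    rw [hη', integral_inner hint, h0, inner_zero_right]
  have hvar : w ⬝ᵥ covMatrix ρ *ᵥ w = ∫ e, η e ^ 2 ∂ρ := by
    rw [dotProduct_covMatrix_mulVec hcoord]
    simp_rw [mul_comm (w _)]
    exact variance_of_integral_eq_zero hηm.aemeasurable hmean
  have hnorm : eLpNorm η 2 ρ = ENNReal.ofReal (√(w ⬝ᵥ covMatrix ρ *ᵥ w)) := by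
    rw [hvar, hL2.eLpNorm_eq_integral_rpow_norm (by norm_num) (by norm_num), Real.sqrt_eq_rpow]
    simp
  refine hasSubgaussianMGF_of_lintegral_exp_sq (by positivity) hηm.aemeasurable hmean
    (lintegral_exp_sq_le_two_of_orliczNorm_lt (hor.2.trans_lt ?_))
  rw [hnorm, ← ENNReal.ofReal_mul hM.le, ENNReal.ofReal_lt_ofReal_iff (by positivity)]
  linarith

theorem trace_noise_eq_sum (Q : Matrix (Fin q) (Fin k) ℝ) :
    (Q * covMatrix ρ * Qᵀ).trace = ∑ j, Q j ⬝ᵥ covMatrix ρ *ᵥ Q j := by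
  rw [Matrix.mul_assoc]
  simp only [Matrix.trace, Matrix.diag, Matrix.mul_apply (M := Q), dotProduct]
  rfl

end noise

theorem exists_sample_threshold (c n : ℝ) : ∃ t₀ : ℕ, ∀ t : ℕ, t₀ ≤ t →
    3 ≤ t ∧ √(Real.log t / t) ≤ 1 / 2 ∧ c * √(Real.log t / t) < 1 ∧ n ≤ t := by
  have h1 : Filter.Tendsto (fun t : ℕ => √(Real.log t / t)) Filter.atTop (nhds 0) := by
    have h := (Real.isLittleO_log_id_atTop.tendsto_div_nhds_zero).comp
      (tendsto_natCast_atTop_atTop (R := ℝ))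
    have := (Real.continuous_sqrt.tendsto 0).comp h
    rwa [Real.sqrt_zero] at this
  have h2 : Filter.Tendsto (fun t : ℕ => c * √(Real.log t / t)) Filter.atTop (nhds 0) := by
    simpa using h1.const_mul c
  have := (Filter.eventually_ge_atTop 3).and ((h1.eventually_le_const (by norm_num : (0:ℝ) < 1 / 2)).and
    ((h2.eventually_lt_const one_pos).and
      (tendsto_natCast_atTop_atTop.eventually_ge_atTop n)))
  exact Filter.eventually_atTop.mp this

theorem one_div_le_sqrt_log_div {t : ℕ} (ht : 3 ≤ t) : 1 / (t : ℝ) ≤ √(Real.log t / t) := by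
  have ht' : (3 : ℝ) ≤ t := by exact_mod_cast ht
  have hlog : 1 ≤ Real.log t := by
    rw [Real.le_log_iff_exp_le (by linarith)]
    linarith [Real.exp_one_lt_d9]
  refine Real.le_sqrt_of_sq_le ?_
  rw [div_pow, div_le_div_iff₀ (by positivity) (by positivity)]
  nlinarith

/-- Entrywise concentration of the sample covariance matrix. -/
theorem measure_sigmaHat_sub_gt_le {Ω : Type*} [MeasurableSpace Ω] {μ : Measure Ω}
    [IsProbabilityMeasure μ] {s : ℕ} {K : ℝ} (hK : 1 ≤ K)
    {ν : Measure (EuclideanSpace ℝ (Fin s))} [IsProbabilityMeasure ν]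
    (h : orliczNorm 2 (fun x => ‖x‖) ν ≤ ENNReal.ofReal K)
    {X : ℕ → Ω → EuclideanSpace ℝ (Fin s)} (hX : ∀ ℓ, Measurable (X ℓ))
    (hXν : ∀ ℓ, μ.map (X ℓ) = ν) (hind : iIndepFun X μ) {t : ℕ} (ht : 3 ≤ t)
    (hr : √(Real.log t / t) ≤ 1 / 2) :
    μ.real {ω | ∃ i j, 2000 * (4 * K ^ 2) ^ 2 * √(Real.log t / t) <
      |sigmaHat (fun ℓ => X ℓ ω) t i j - covMatrix ν i j|} ≤
        ((s : ℝ) ^ 2 + s) * (2 / (t : ℝ) ^ 3) := by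
  set κ := 4 * K ^ 2 with hκ
  have hκ1 : 1 ≤ κ := by nlinarith
  have hκ0 : 0 < κ := by linarith
  set r := √(Real.log t / t) with hrdef
  have ht' : (3 : ℝ) ≤ t := by exact_mod_cast ht
  have hlaw : ∀ f : EuclideanSpace ℝ (Fin s) → ℝ, Measurable f →
      ∫⁻ x, ENNReal.ofReal (Real.exp (|f x| / κ)) ∂ν ≤ 4 →
      |∫ x, f x ∂ν| ≤ 4 * κ ∧ μ.real {ω | 35 * κ * r ≤
        |1 / (t : ℝ) * (∑ ℓ ∈ Finset.range t, f (X ℓ ω)) - ∫ x, f x ∂ν|} ≤ 2 / (t : ℝ) ^ 3 := by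
    intro f hf hle
    refine ⟨(abs_integral_le_of_lintegral_exp_abs hκ0 hf.aemeasurable hle).2, ?_⟩
    refine measure_abs_mean_sub_ge_le (U := fun ℓ ω => f (X ℓ ω)) hκ0 (fun ℓ => hf.comp (hX ℓ))
      (hind.comp (fun _ => f) fun _ => hf) (fun ℓ => ?_) (fun ℓ => ?_) (by omega) hr
    · rwa [← hXν ℓ, lintegral_map (by fun_prop) (hX ℓ)] at hle
    · rw [← hXν ℓ, integral_map (hX ℓ).aemeasurable hf.aestronglyMeasurable]
  have h1 := fun i : Fin s => hlaw (fun x => x i) (by fun_prop) (lintegral_exp_coord_le hK h i)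
  have h2 := fun p : Fin s × Fin s => hlaw (fun x => x p.1 * x p.2) (by fun_prop)
    (lintegral_exp_coord_mul_le hK h p.1 p.2)
  let B1 : Fin s → Set Ω := fun i => {ω | 35 * κ * r ≤
    |1 / (t : ℝ) * (∑ ℓ ∈ Finset.range t, X ℓ ω i) - ∫ x, x i ∂ν|}
  let B2 : Fin s × Fin s → Set Ω := fun p => {ω | 35 * κ * r ≤
    |1 / (t : ℝ) * (∑ ℓ ∈ Finset.range t, X ℓ ω p.1 * X ℓ ω p.2) - ∫ x, x p.1 * x p.2 ∂ν|}
  have hsub : {ω | ∃ i j, 2000 * κ ^ 2 * r <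
      |sigmaHat (fun ℓ => X ℓ ω) t i j - covMatrix ν i j|} ⊆ (⋃ p, B2 p) ∪ ⋃ i, B1 i := by
    rintro ω ⟨i, j, hij⟩
    by_contra hcon
    simp only [Set.mem_union, Set.mem_iUnion, not_or, not_exists] at hcon
    have g1 : ∀ i, |1 / (t : ℝ) * (∑ ℓ ∈ Finset.range t, X ℓ ω i) - ∫ x, x i ∂ν| ≤
        35 * κ * r := fun i => le_of_not_ge (hcon.2 i)
    have g2 : |1 / (t : ℝ) * (∑ ℓ ∈ Finset.range t, X ℓ ω i * X ℓ ω j) - ∫ x, x i * x j ∂ν| ≤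
        35 * κ * r := le_of_not_ge (hcon.1 (i, j))
    have hcov : covMatrix ν i j = (∫ x, x i * x j ∂ν) - (∫ x, x i ∂ν) * ∫ x, x j ∂ν :=
      covariance_eq_sub (memLp_two_coord hK h i) (memLp_two_coord hK h j)
    have := abs_sample_covariance_sub_le hκ1 (Real.sqrt_nonneg _) hr (by linarith)
      (one_div_le_sqrt_log_div ht) (h2 (i, j)).1 (h1 i).1 (h1 j).1 g2 (g1 i) (g1 j)
    rw [sigmaHat_apply_eq _ (by omega), hcov] at hij
    exact absurd hij (not_lt.mpr this)
  calc _ ≤ _ := measureReal_mono hsub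
    _ ≤ _ := measureReal_union_le _ _
    _ ≤ ∑ p, μ.real (B2 p) + ∑ i, μ.real (B1 i) :=
        add_le_add (measureReal_iUnion_fintype_le _) (measureReal_iUnion_fintype_le _)
    _ ≤ ∑ _p : Fin s × Fin s, 2 / (t : ℝ) ^ 3 + ∑ _i : Fin s, 2 / (t : ℝ) ^ 3 :=
        add_le_add (Finset.sum_le_sum fun p _ => (h2 p).2) (Finset.sum_le_sum fun i _ => (h1 i).2)
    _ = _ := by
        simp only [Finset.sum_const, Finset.card_univ, Fintype.card_prod, Fintype.card_fin,
          nsmul_eq_mul]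
        push_cast
        ring

theorem abs_covMatrix_le {s : ℕ} {K : ℝ} (hK : 1 ≤ K)
    {ν : Measure (EuclideanSpace ℝ (Fin s))} [IsProbabilityMeasure ν]
    (h : orliczNorm 2 (fun x => ‖x‖) ν ≤ ENNReal.ofReal K) (i j : Fin s) :
    |covMatrix ν i j| ≤ 20 * (4 * K ^ 2) ^ 2 := by
  have hκ1 : 1 ≤ 4 * K ^ 2 := by nlinarith
  have hκ0 : 0 < 4 * K ^ 2 := by linarith
  have hcov : covMatrix ν i j = (∫ x, x i * x j ∂ν) - (∫ x, x i ∂ν) * ∫ x, x j ∂ν :=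
    covariance_eq_sub (memLp_two_coord hK h i) (memLp_two_coord hK h j)
  have h1 := fun i => (abs_integral_le_of_lintegral_exp_abs hκ0 (by fun_prop)
    (lintegral_exp_coord_le hK h i)).2
  have h2 := (abs_integral_le_of_lintegral_exp_abs hκ0 (by fun_prop)
    (lintegral_exp_coord_mul_le hK h i j)).2
  rw [hcov]
  refine (abs_sub _ _).trans ?_
  rw [abs_mul]
  have := mul_le_mul (h1 i) (h1 j) (abs_nonneg _) (by positivity)
  nlinarith

/-- The constant in the relative error bound, before division by the lower bound on `‖Σ‖₂`. -/
noncomputable def errorConst (s : ℕ) (K L M : ℝ) : ℝ :=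
  s * (2000 * (4 * K ^ 2) ^ 2) +
    4 * √(s * (1020 * (4 * K ^ 2) ^ 2) * (48 * s * (M ^ 2 + 1) * L)) + 48 * s * (M ^ 2 + 1) * L

theorem relative_error_le {s k q : ℕ} {K L M τ : ℝ} (hK : 1 ≤ K) (hL : 0 < L) (hτ : 0 < τ)
    (Q : Matrix (Fin q) (Fin k) ℝ) (β : Matrix (Fin k) (Fin s) ℝ)
    {S : Matrix (Fin s) (Fin s) ℝ} (hS : Sᵀ = S) (hpos : ∀ x, 0 ≤ x ⬝ᵥ S *ᵥ x)
    (hdet : S.det ≠ 0) (hSτ : τ ≤ specNorm S) (hSle : ∀ i j, |S i j| ≤ 20 * (4 * K ^ 2) ^ 2)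
    (hb : 0 < (Q * β * βᵀ * Qᵀ).trace) {t : ℕ} (ht : 3 ≤ t)
    (hr : √(Real.log t / t) ≤ 1 / 2) {x : ℕ → EuclideanSpace ℝ (Fin s)}
    {y ε : ℕ → EuclideanSpace ℝ (Fin k)}
    (hy : ∀ ℓ, y ℓ = WithLp.toLp 2 (β *ᵥ (x ℓ).ofLp) + ε ℓ)
    (hgram : ((dataMatrix x t)ᵀ * dataMatrix x t).det ≠ 0)
    (hsig : ∀ i j, |sigmaHat x t i j - S i j| ≤ 2000 * (4 * K ^ 2) ^ 2 * √(Real.log t / t))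
    (hF : projSq (dataMatrix x t) (dataMatrix ε t * Qᵀ) ≤
      48 * s * (M ^ 2 + 1) * L * (Q * β * βᵀ * Qᵀ).trace * Real.log t) :
    |riskTrace Q (sigmaHat x t) (betaHat x y t) - riskTrace Q S β| / riskTrace Q S β ≤
      errorConst s K L M / τ * condNumber S * √(Real.log t / t) := by
  have ht' : (3 : ℝ) ≤ t := by exact_mod_cast ht
  have ht1 : (0 : ℝ) < (t : ℝ) - 1 := by linarith
  set κ2 := (4 * K ^ 2) ^ 2 with hκ2
  set c0 := 48 * s * (M ^ 2 + 1) * L with hc0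
  set c1 := s * (1020 * κ2) with hc1
  have hκ20 : 0 ≤ κ2 := by positivity
  have hc00 : 0 ≤ c0 := by positivity
  have hc10 : 0 ≤ c1 := by positivity
  set b := (Q * β * βᵀ * Qᵀ).trace with hbdef
  set r := √(Real.log t / t) with hrdef
  have hr0 : 0 ≤ r := Real.sqrt_nonneg _
  have hlog : Real.log t = r ^ 2 * t := by
    rw [hrdef, Real.sq_sqrt (div_nonneg (Real.log_natCast_nonneg t) (by linarith))]
    field_simp
  set F := projSq (dataMatrix x t) (dataMatrix ε t * Qᵀ) with hFdef
  have hF0 : 0 ≤ F := by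
    rw [hFdef, projSq_eq]
    positivity
  have hinv : 1 / ((t : ℝ) - 1) ≤ 2 / t := by
    rw [div_le_div_iff₀ ht1 (by linarith)]
    linarith
  have hsighat : riskTrace Q (sigmaHat x t) β ≤ c1 * b := by
    have hle : ∀ i j, |sigmaHat x t i j| ≤ 1020 * κ2 := fun i j => by
      have h1 := abs_add_le (sigmaHat x t i j - S i j) (S i j)
      rw [sub_add_cancel] at h1
      have h2 : 2000 * κ2 * r ≤ 2000 * κ2 * (1 / 2) := by gcongr
      linarith [hsig i j, hSle i j]
    exact (le_abs_self _).trans (abs_riskTrace_le Q β hle)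
  have hA : |riskTrace Q (sigmaHat x t) (betaHat x y t) - riskTrace Q (sigmaHat x t) β| ≤
      (4 * √(c1 * c0) + c0) * b * r := by
    refine (abs_riskTrace_betaHat_sub_le Q β x t (by omega) hgram hy).trans ?_
    have hFr : F ≤ c0 * b * (r ^ 2 * t) := hF.trans_eq (by rw [hlog])
    have hsq : √(((t : ℝ) - 1) * riskTrace Q (sigmaHat x t) β * F) ≤ √(c1 * c0) * (b * r * t) := by
      rw [Real.sqrt_le_left (by positivity), mul_pow, Real.sq_sqrt (by positivity)]
      calc ((t : ℝ) - 1) * riskTrace Q (sigmaHat x t) β * F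
          ≤ t * (c1 * b) * (c0 * b * (r ^ 2 * t)) := by
            refine mul_le_mul ?_ hFr hF0 (by positivity)
            exact (mul_le_mul_of_nonneg_left hsighat ht1.le).trans
              (mul_le_mul_of_nonneg_right (by linarith) (by positivity))
        _ = c1 * c0 * (b * r * t) ^ 2 := by ring
    calc _ ≤ 2 / (t : ℝ) * (2 * (√(c1 * c0) * (b * r * t)) + c0 * b * (r ^ 2 * t)) := by
          gcongr
      _ = 4 * √(c1 * c0) * b * r + c0 * b * r * (2 * r) := by
          field_simp
          ring
      _ ≤ 4 * √(c1 * c0) * b * r + c0 * b * r * 1 := by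
          gcongr
          linarith
      _ = _ := by ring
  have hB : |riskTrace Q (sigmaHat x t) β - riskTrace Q S β| ≤ s * (2000 * κ2) * b * r := by
    rw [← riskTrace_sub]
    refine (abs_riskTrace_le Q β (S := sigmaHat x t - S) hsig).trans_eq ?_
    ring
  have htot : |riskTrace Q (sigmaHat x t) (betaHat x y t) - riskTrace Q S β| ≤
      errorConst s K L M * b * r := by
    refine (abs_sub_le _ (riskTrace Q (sigmaHat x t) β) _).trans ((add_le_add hA hB).trans_eq ?_)
    rw [errorConst]
    ring
  have hE0 : 0 ≤ errorConst s K L M := by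
    rw [errorConst]
    positivity
  have hbR := trace_coeff_le_specNorm_inv_mul_riskTrace Q β hS hpos hdet
  have hn0 := specNorm_nonneg S⁻¹
  have hR : 0 < riskTrace Q S β := by
    by_contra hcon
    have := mul_nonpos_of_nonneg_of_nonpos hn0 (not_lt.mp hcon)
    linarith
  rw [div_le_iff₀ hR]
  refine htot.trans ?_
  rw [condNumber]
  calc errorConst s K L M * b * r
      ≤ errorConst s K L M * (specNorm S⁻¹ * riskTrace Q S β) * r := by gcongr
    _ = errorConst s K L M / τ * (τ * specNorm S⁻¹) * r * riskTrace Q S β := by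
        field_simp
    _ ≤ errorConst s K L M / τ * (specNorm S * specNorm S⁻¹) * r * riskTrace Q S β := by
        gcongr

end LRMC

theorem mainTheorem6
    (s : ℕ) (hs : 0 < s) (K L M τ : ℝ) (hK : 1 ≤ K) (hL : 0 < L) (hM : 0 < M) (hτ : 0 < τ) :
    ∃ C : ℝ, 0 < C ∧
      -- the law `ν` of the regressor vector (no intercept)
      ∀ (ν : Measure (EuclideanSpace ℝ (Fin s))) [IsProbabilityMeasure ν],
        (∀ θ : EuclideanSpace ℝ (Fin s), ‖θ‖ = 1 →
          eLpNorm (fun x => inner ℝ x θ) 4 ν ≤ ENNReal.ofReal K) →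
        LRMC.orliczNorm 2 (fun x => ‖x‖) ν ≤ ENNReal.ofReal K →
        (LRMC.covMatrix ν).det ≠ 0 →
        τ ≤ LRMC.specNorm (LRMC.covMatrix ν) →
        ∃ t₀ : ℕ,
          -- response dimension, weight matrix, coefficients, law `ρ` of the noise
          ∀ (k₀ q : ℕ) (Q : Matrix (Fin q) (Fin k₀) ℝ) (β : Matrix (Fin k₀) (Fin s) ℝ)
            (ρ : Measure (EuclideanSpace ℝ (Fin k₀))) [IsProbabilityMeasure ρ],
            ∫ e, e ∂ρ = 0 →
            (∀ θ : EuclideanSpace ℝ (Fin k₀),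
              LRMC.orliczNorm 2 (fun e => inner ℝ e θ) ρ ≠ ⊤ ∧
              LRMC.orliczNorm 2 (fun e => inner ℝ e θ) ρ ≤
                ENNReal.ofReal M * eLpNorm (fun e => inner ℝ e θ) 2 ρ) →
            0 < (Q * β * βᵀ * Qᵀ).trace →
            (Q * LRMC.covMatrix ρ * Qᵀ).trace / (Q * β * βᵀ * Qᵀ).trace ≤ L →
            -- i.i.d. samples of the linear model
            ∀ (Ω : Type*) [MeasurableSpace Ω] (μ : Measure Ω) [IsProbabilityMeasure μ]
              (X : ℕ → Ω → EuclideanSpace ℝ (Fin s)) (ε Y : ℕ → Ω → EuclideanSpace ℝ (Fin k₀)),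
              (∀ ℓ, Measurable (X ℓ)) → (∀ ℓ, Measurable (ε ℓ)) →
              (∀ ℓ, μ.map (X ℓ) = ν) → (∀ ℓ, μ.map (ε ℓ) = ρ) →
              (∀ ℓ, IndepFun (X ℓ) (ε ℓ) μ) →
              iIndepFun (fun ℓ ω => (X ℓ ω, ε ℓ ω)) μ →
              (∀ ℓ ω, Y ℓ ω = WithLp.toLp 2 (β *ᵥ (X ℓ ω).ofLp) + ε ℓ ω) →
              ∀ t : ℕ, t₀ ≤ t →
                1 - 1 / (t : ℝ) ^ 2 ≤
                  μ.real {ω |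
                    (LRMC.dataMatrix (fun ℓ => X ℓ ω) t).rank = s ∧
                    |LRMC.riskTrace Q (LRMC.sigmaHat (fun ℓ => X ℓ ω) t)
                          (LRMC.betaHat (fun ℓ => X ℓ ω) (fun ℓ => Y ℓ ω) t)
                        - LRMC.riskTrace Q (LRMC.covMatrix ν) β|
                      / LRMC.riskTrace Q (LRMC.covMatrix ν) β
                      ≤ C * LRMC.condNumber (LRMC.covMatrix ν) *
                          Real.sqrt (Real.log t / t)} := by
  refine ⟨LRMC.errorConst s K L M / τ, div_pos (by rw [LRMC.errorConst]; positivity) hτ, ?_⟩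
  intro ν _ _ hψ hdet hSτ
  obtain ⟨t₀, ht₀⟩ := LRMC.exists_sample_threshold
    (LRMC.specNorm (LRMC.covMatrix ν)⁻¹ * (s * (2000 * (4 * K ^ 2) ^ 2)))
    (2 * ((s : ℝ) ^ 2 + s + 1))
  refine ⟨t₀, ?_⟩
  intro k₀ q Q β ρ _ h0 hnoise hb hratio Ω _ μ _ X ε Y hX hε hXν hερ hXε hind hY t ht
  obtain ⟨ht3, hr, hsmall, hlarge⟩ := ht₀ t ht
  have htpos : (0 : ℝ) < t := by
    have : (3 : ℝ) ≤ t := by exact_mod_cast ht3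
    linarith
  set b := (Q * β * βᵀ * Qᵀ).trace with hbdef
  have hq : 0 < q := by
    rcases Nat.eq_zero_or_pos q with rfl | hq
    · simp [hbdef, Matrix.trace] at hb
    · exact hq
  have hq' : (0 : ℝ) < q := Nat.cast_pos.mpr hq
  have hcoordX := LRMC.memLp_two_coord hK hψ
  have hpos := LRMC.covMatrix_quadratic_nonneg hcoordX
  set δ := √(L * b / q) with hδdef
  have hδ : 0 < δ := Real.sqrt_pos.mpr (by positivity)
  have hδ2 : q * δ ^ 2 = L * b := by
    rw [hδdef, Real.sq_sqrt (by positivity)]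
    field_simp
  have hcoordε : ∀ i, MemLp (fun e : EuclideanSpace ℝ (Fin k₀) => e i) 2 ρ := fun i => by
    have := LRMC.memLp_two_of_orliczNorm_ne_top (by fun_prop)
      (hnoise (EuclideanSpace.single i 1)).1
    simpa [EuclideanSpace.inner_single_right] using this
  have hΓ : ∀ j, 0 ≤ Q j ⬝ᵥ LRMC.covMatrix ρ *ᵥ Q j := fun j =>
    LRMC.covMatrix_quadratic_nonneg hcoordε _
  let V : Fin q → NNReal := fun j =>
    (2 * (M * √(Q j ⬝ᵥ LRMC.covMatrix ρ *ᵥ Q j) + δ) ^ 2).toNNReal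
  have hVpos : ∀ j, 0 < V j := fun j => Real.toNNReal_pos.mpr (by positivity)
  have hVsum : 0 < ∑ j, (V j : ℝ) :=
    Finset.sum_pos (fun j _ => hVpos j) ⟨⟨0, hq⟩, Finset.mem_univ _⟩
  have hVle : ∑ j, (V j : ℝ) ≤ 4 * (M ^ 2 + 1) * (L * b) := by
    have h1 : ∀ j, (V j : ℝ) ≤ 4 * M ^ 2 * (Q j ⬝ᵥ LRMC.covMatrix ρ *ᵥ Q j) + 4 * δ ^ 2 :=
      fun j => by
        rw [Real.coe_toNNReal _ (by positivity)]
        nlinarith [sq_nonneg (M * √(Q j ⬝ᵥ LRMC.covMatrix ρ *ᵥ Q j) - δ), Real.sq_sqrt (hΓ j)]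
    have h2 : ∑ j, (Q j ⬝ᵥ LRMC.covMatrix ρ *ᵥ Q j) ≤ L * b := by
      rw [← LRMC.trace_noise_eq_sum]
      exact (div_le_iff₀ hb).mp hratio
    calc ∑ j, (V j : ℝ) ≤ ∑ j, (4 * M ^ 2 * (Q j ⬝ᵥ LRMC.covMatrix ρ *ᵥ Q j) + 4 * δ ^ 2) :=
          Finset.sum_le_sum fun j _ => h1 j
      _ = 4 * M ^ 2 * ∑ j, (Q j ⬝ᵥ LRMC.covMatrix ρ *ᵥ Q j) + 4 * (q * δ ^ 2) := by
          rw [Finset.sum_add_distrib, ← Finset.mul_sum]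
          simp only [Finset.sum_const, Finset.card_univ, Fintype.card_fin, nsmul_eq_mul]
          ring
      _ ≤ 4 * M ^ 2 * (L * b) + 4 * (q * δ ^ 2) := by gcongr
      _ = _ := by
          rw [hδ2]
          ring
  have hBF := LRMC.measure_projSq_ge_le hs hX hε hXν hερ hXε hind
    (η := fun (j : Fin q) (e : EuclideanSpace ℝ (Fin k₀)) => ∑ a, e a * Q j a)
    (fun j => by fun_prop) hVpos
    (fun j => LRMC.noise_hasSubgaussianMGF hM h0 hnoise hδ (Q j)) hVsum (t := t) (by omega)
  have hindX : iIndepFun X μ := hind.comp (fun _ p => p.1) fun _ => measurable_fst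
  have hBX := LRMC.measure_sigmaHat_sub_gt_le hK hψ hX hXν hindX ht3 hr
  set BF := {ω | 4 * s * (∑ j, (V j : ℝ)) * (3 * Real.log t) ≤
    LRMC.projSq (LRMC.dataMatrix (fun ℓ => X ℓ ω) t)
      (Matrix.of fun (ℓ : Fin t) (j : Fin q) => ∑ a, (ε ℓ ω) a * Q j a)} with hBFdef
  set BX := {ω | ∃ i j, 2000 * (4 * K ^ 2) ^ 2 * √(Real.log t / t) <
      |LRMC.sigmaHat (fun ℓ => X ℓ ω) t i j - LRMC.covMatrix ν i j|} with hBXdef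
  set G := {ω | (LRMC.dataMatrix (fun ℓ => X ℓ ω) t).rank = s ∧
    |LRMC.riskTrace Q (LRMC.sigmaHat (fun ℓ => X ℓ ω) t)
          (LRMC.betaHat (fun ℓ => X ℓ ω) (fun ℓ => Y ℓ ω) t)
        - LRMC.riskTrace Q (LRMC.covMatrix ν) β|
      / LRMC.riskTrace Q (LRMC.covMatrix ν) β
      ≤ LRMC.errorConst s K L M / τ * LRMC.condNumber (LRMC.covMatrix ν) *
          √(Real.log t / t)} with hGdef
  have hcover : (Set.univ : Set Ω) ⊆ G ∪ (BX ∪ BF) := by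
    intro ω _
    by_contra hcon
    simp only [Set.mem_union, not_or] at hcon
    obtain ⟨hG, hBXω, hBFω⟩ := hcon
    refine hG ?_
    have hsig : ∀ i j, |LRMC.sigmaHat (fun ℓ => X ℓ ω) t i j - LRMC.covMatrix ν i j| ≤
        2000 * (4 * K ^ 2) ^ 2 * √(Real.log t / t) := fun i j => by
      by_contra! hlt
      exact hBXω ⟨i, j, hlt⟩
    have hgram := LRMC.det_gram_ne_zero (fun ℓ => X ℓ ω) t (LRMC.covMatrix_transpose ν) hpos hdet
      hsig (by simpa only [mul_assoc] using hsmall)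
    refine ⟨LRMC.rank_dataMatrix_of_det_ne_zero _ _ hgram, ?_⟩
    refine LRMC.relative_error_le hK hL hτ Q β (LRMC.covMatrix_transpose ν) hpos hdet hSτ
      (LRMC.abs_covMatrix_le hK hψ) hb ht3 hr (ε := fun ℓ => ε ℓ ω) (fun ℓ => hY ℓ ω) hgram hsig ?_
    have hF : LRMC.projSq (LRMC.dataMatrix (fun ℓ => X ℓ ω) t)
        (LRMC.dataMatrix (fun ℓ => ε ℓ ω) t * Qᵀ) <
          4 * s * (∑ j, (V j : ℝ)) * (3 * Real.log t) := not_le.mp hBFω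
    refine hF.le.trans ?_
    have hlog0 : 0 ≤ Real.log t := Real.log_natCast_nonneg t
    calc 4 * s * (∑ j, (V j : ℝ)) * (3 * Real.log t)
        ≤ 4 * s * (4 * (M ^ 2 + 1) * (L * b)) * (3 * Real.log t) := by gcongr
      _ = 48 * s * (M ^ 2 + 1) * L * b * Real.log t := by ring
  have hone : 1 ≤ μ.real G + (((s : ℝ) ^ 2 + s) * (2 / (t : ℝ) ^ 3) + 2 / (t : ℝ) ^ 3) := by
    calc (1 : ℝ) = μ.real Set.univ := probReal_univ.symm
      _ ≤ μ.real (G ∪ (BX ∪ BF)) := measureReal_mono hcover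
      _ ≤ μ.real G + (μ.real BX + μ.real BF) :=
          (measureReal_union_le _ _).trans (by gcongr; exact measureReal_union_le _ _)
      _ ≤ _ := by gcongr
  have hfin : ((s : ℝ) ^ 2 + s) * (2 / (t : ℝ) ^ 3) + 2 / (t : ℝ) ^ 3 ≤ 1 / (t : ℝ) ^ 2 := by
    have e : ((s : ℝ) ^ 2 + s) * (2 / (t : ℝ) ^ 3) + 2 / (t : ℝ) ^ 3 =
        2 * ((s : ℝ) ^ 2 + s + 1) / (t : ℝ) ^ 3 := by ring
    rw [e, div_le_div_iff₀ (by positivity) (by positivity)]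
    have := mul_le_mul_of_nonneg_right hlarge (sq_nonneg (t : ℝ))
    nlinarith
  linarith
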